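/- Let $n,p,q,L\ge 1$ be integers and let $\mathbf X\in[-1,1]^{n\times p}$ have exactly $q$ non-zero entries in each row. Random-sign min-wise hashing: let $\pi_1,\dots,\pi_L$ be i.i.d. uniformly distributed permutations of $\{1,\dots,p\}$ and let $\boldsymbol\Psi\in\{-1,1\}^{p\times L}$ be a matrix of i.i.d. uniform signs, independent of the permutations. For each $i,l$ let $H_{il}$ be the minimiser of $\pi_l(k)$ over $\{k: X_{ik}\ne 0\}$, and let $\mathbf S\in\mathbb R^{n\times L}$ have entries $S_{il}=\Psi_{H_{il}l}X_{iH_{il}}$. Let $\mathbf Y=\alpha^*\mathbf 1+\mathbf X\boldsymbol\beta^*+\boldsymbol\gamma+\boldsymbol\varepsilon$, where $\alpha^*\in\mathbb R$, $\boldsymbol\beta^*\in\mathbb R^p$, $\boldsymbol\gamma\in\mathbb R^n$ are deterministic with $\boldsymbol\gamma^T\mathbf 1=0$, and $\boldsymbol\varepsilon$ is a random vector in $\mathbb R^n$, independent of $(\boldsymbol\pi,\boldsymbol\Psi)$, with $\mathbb E\varepsilon_i=0$, $\mathbb E\varepsilon_i^2=\sigma^2>0$ and $\mathrm{Cov}(\varepsilon_i,\varepsilon_j)=0$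 for $i\ne j$. Let $\eta>0$ and let $(\hat\alpha,\hat{\mathbf b}^\eta)$ be a (measurable) minimiser of $\|\mathbf Y-\alpha\mathbf 1-\mathbf S\mathbf b\|_2^2$ over all $\alpha\in\mathbb R$ and all $\mathbf b\in\mathbb R^L$ with $\|\mathbf b\|_2^2\le(1+\eta)(2-q/p)q\|\boldsymbol\beta^*\|_2^2/L$. Put $$L^*=\frac{\sqrt{(2-q/p)qn}\,\|\boldsymbol\beta^*\|_2}{\sigma},\qquad \delta=\frac qp,\qquad \rho=\exp\Big(-\frac{L\eta^2}{2(2-\delta)(3+2\eta)q}\Big),\qquad \overline{\mathbf X\boldsymbol\beta^*}=\frac1n\sum_{i=1}^n(\mathbf X\boldsymbol\beta^*)_i .$$ Then the squared prediction errors below are integrable. The mean squared prediction error relative to the mean response satisfies $$\frac1n\,\mathbb E_{\boldsymbol\varepsilon,\boldsymbol\pi,\boldsymbol\Psi}\big\|\alpha^*\mathbf 1+\mathbf X\boldsymbol\beta^*+\boldsymbol\gamma-\hat\alpha\mathbf 1-\mathbf S\hat{\mathbf b}^\eta\big\|_2^2\le\sqrt{(2-q/p)q}\,\|\boldsymbol\beta^*\|_2\,\frac{\sigma\big(2\sqrt{1+\eta}+L^*/L\big)}{\sqrt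 n}+\rho\,\frac{\|\mathbf X\boldsymbol\beta^*-\overline{\mathbf X\boldsymbol\beta^*}\mathbf 1+\boldsymbol\gamma\|_2^2}{n}+\frac{\|\boldsymbol\gamma\|_2^2}{n}+\frac{\sigma^2}{n},$$ and the error relative to the linear part alone satisfies $$\frac1n\,\mathbb E_{\boldsymbol\varepsilon,\boldsymbol\pi,\boldsymbol\Psi}\big\|\alpha^*\mathbf 1+\mathbf X\boldsymbol\beta^*-\hat\alpha\mathbf 1-\mathbf S\hat{\mathbf b}^\eta\big\|_2^2\le\sqrt{(2-q/p)q}\,\|\boldsymbol\beta^*\|_2\,\frac{\sigma\big(2\sqrt{1+\eta}+L^*/L\big)}{\sqrt n}+\rho\,\frac{\|\mathbf X\boldsymbol\beta^*-\overline{\mathbf X\boldsymbol\beta^*}\mathbf 1\|_2^2}{n}+\frac{\|\boldsymbol\gamma\|_2^2}{n}+\frac{\sigma^2}{n}.$$ -/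

import Mathlib

open MeasureTheory ProbabilityTheory Matrix

noncomputable section

/-- The Euclidean norm of a real vector given by its coordinates. -/
def l2norm {ι : Type*} [Fintype ι] (v : ι → ℝ) : ℝ := ‖WithLp.toLp 2 v‖

/-- The arithmetic mean of the coordinates of a vector. -/
def vecMean {n : ℕ} (v : Fin n → ℝ) : ℝ := (∑ i, v i) / n

/-- The set of indices of the non-zero entries in row `i` of the design matrix. -/
def activeSet {n p : ℕ} (X : Matrix (Fin n) (Fin p) ℝ) (i : Fin n) : Finset (Fin p) := by
  classical exact Finset.univ.filter fun k => X i k ≠ 0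

/-- The index of the element of `z` that comes first in the order given by the permutation `τ`,
i.e. the minimiser of `τ` over `z`. -/
def minHash {p : ℕ} (τ : Equiv.Perm (Fin p)) (z : Finset (Fin p)) (hz : z.Nonempty) : Fin p :=
  τ.symm ((z.image τ).min' (hz.image τ))

theorem minHash_mem {p : ℕ} (τ : Equiv.Perm (Fin p)) (z : Finset (Fin p)) (hz : z.Nonempty) :
    minHash τ z hz ∈ z := by
  obtain ⟨k, hk, h⟩ := Finset.mem_image.1 ((z.image τ).min'_mem (hz.image τ))
  rw [minHash, ← h, Equiv.symm_apply_apply]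
  exact hk

theorem apply_minHash_le {p : ℕ} (τ : Equiv.Perm (Fin p)) (z : Finset (Fin p)) (hz : z.Nonempty)
    {k : Fin p} (hk : k ∈ z) : τ (minHash τ z hz) ≤ τ k := by
  rw [minHash, Equiv.apply_symm_apply]
  exact Finset.min'_le _ _ (Finset.mem_image_of_mem τ hk)

/-- The randomness of the hashing scheme: `L` permutations of the `p` variables, and a `p × L`
matrix of signs. -/
def HashSeed (p L : ℕ) : Type := (Fin L → Equiv.Perm (Fin p)) × Matrix (Fin p) (Fin L) ℤˣ

instance (p L : ℕ) : Fintype (HashSeed p L) :=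
  inferInstanceAs (Fintype ((Fin L → Equiv.Perm (Fin p)) × (Fin p → Fin L → ℤˣ)))

instance (p L : ℕ) : MeasurableSpace (HashSeed p L) := ⊤

/-- The permutation used for column `l`. -/
def HashSeed.perm {p L : ℕ} (s : HashSeed p L) (l : Fin L) : Equiv.Perm (Fin p) := s.1 l

/-- The sign attached to variable `k` in column `l`. -/
def HashSeed.sign {p L : ℕ} (s : HashSeed p L) (k : Fin p) (l : Fin L) : ℤˣ := s.2 k l

open Classical in
/-- The compressed `n × L` matrix of random-sign min-wise hashing: its entry at `(i, l)` is the sign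
of variable `H` in column `l` times `X i H`, where `H` is the non-zero variable of row `i` that
comes first in the order of the `l`-th permutation. (A zero row is mapped to zero.) -/
def signHash {n p L : ℕ} (X : Matrix (Fin n) (Fin p) ℝ) (s : HashSeed p L) :
    Matrix (Fin n) (Fin L) ℝ := fun i l =>
  if hz : (activeSet X i).Nonempty then
    (((s.sign (minHash (s.perm l) (activeSet X i) hz) l : ℤˣ) : ℤ) : ℝ) *
      X i (minHash (s.perm l) (activeSet X i) hz)
  else 0

/-- The vector `a 1 + S b` of fitted values. -/
def fittedValues {n L : ℕ} (S : Matrix (Fin n) (Fin L) ℝ) (a : ℝ) (b : Fin L → ℝ) : Fin n → ℝ :=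
  fun i => a + (S *ᵥ b) i

/-- `(a, b)` minimises `‖y - a 1 - S b‖²` over all intercepts `a` and all coefficient vectors `b`
with `‖b‖² ≤ r`. -/
def IsRidgeFit {n L : ℕ} (S : Matrix (Fin n) (Fin L) ℝ) (y : Fin n → ℝ) (r : ℝ)
    (a : ℝ) (b : Fin L → ℝ) : Prop :=
  l2norm b ^ 2 ≤ r ∧ ∀ (a' : ℝ) (b' : Fin L → ℝ), l2norm b' ^ 2 ≤ r →
    l2norm (y - fittedValues S a b) ^ 2 ≤ l2norm (y - fittedValues S a' b') ^ 2

/-- The squared error of the fit `(a, b)` on the compressed matrix `S`, relative to the target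
vector `m`. -/
def sqError {n L : ℕ} (m : Fin n → ℝ) (S : Matrix (Fin n) (Fin L) ℝ) (a : ℝ) (b : Fin L → ℝ) : ℝ :=
  l2norm (m - fittedValues S a b) ^ 2

/-- The constant `L* = √((2 - q/p) q n) ‖β‖ / σ`. -/
def LStar (n p q : ℕ) (β : Fin p → ℝ) (σ : ℝ) : ℝ :=
  √((2 - (q : ℝ) / p) * q * n) * l2norm β / σ

/-- The bound `(1 + η) (2 - q/p) q ‖β‖² / L` on the squared norm of the coefficients. -/
def ridgeRadiusSq (p q L : ℕ) (β : Fin p → ℝ) (η : ℝ) : ℝ :=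
  (1 + η) * ((2 - (q : ℝ) / p) * q * l2norm β ^ 2 / L)

/-- `ρ = exp (-L η² / (2 (2 - δ) (3 + 2η) q))` with `δ = q / p`. -/
def ridgeRho (p q L : ℕ) (η : ℝ) : ℝ :=
  Real.exp (-(L * η ^ 2 / (2 * (2 - (q : ℝ) / p) * (3 + 2 * η) * q)))

end

/-!
The linear predictor `X β` is approximated by `S b`, where the coefficient of column `l` is
`b l = (q / L) * ∑ k, β k * w (π_l k) * Ψ k l` and the weight `w` of a rank is a multiple of
`(1 - q / p) ^ rank`. Averaging over the signs leaves only the hashed variable in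
`S i l * b l`. Given the rank of the hashed variable, each of the `q` active variables is equally
likely to be the hashed one, so the approximation is unbiased as soon as `w` has mean one at that
rank (`expect_hashEntry_mul_hashCoef`). The rank is stochastically smaller than a geometric
variable of parameter `q / p` (`le_expect_pow_rank_minHash`); therefore the normalised weights are
at most `2 - q / p`, and their mean square is at most `(2 - q / p) / q` (`exists_rank_weights`).
The columns are independent, which bounds the variance of the approximation. Since `b l` is a
Rademacher sum given the permutation, its square has the exponential moments required by
Bernstein's inequality (`expect_exp_hashCoef_sq_le`), and `‖b‖²` exceeds the radius of the
constraint with probability at most `ρ`. These facts are `exists_signHash_approximation`.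

The estimator is the projection of the responses onto the convex set of admissible fits. The
variational inequality for this projection gives the oracle inequality `IsRidgeFit.sqError_le`,
which is used with `b` where `b` is admissible and with `0` elsewhere; the latter accounts for the
term with the factor `ρ`. The unconstrained intercept contributes the squared mean of the noise,
hence `σ² / n`. The inner product of the noise with the estimated fit is at most the radius times
the norm of the image of the noise under the transpose of the centred matrix; the inner product
with the comparison fit has mean zero, because the seed is independent of the noise.

The two claims differ only in how `γ` is split into a part of the target and a perturbation of the
responses (`integral_sqError_le`). In the target, `γ` is left over as a bias of the approximation;
as a perturbation, it is absorbed by the quadratic term that the variational inequality leaves. Both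
cost `‖γ‖²`.
-/

section
open scoped BigOperators

/-! ### Ranks under a uniform permutation -/

theorem expect_perm_apply {p : ℕ} (f : Fin p → ℝ) (k : Fin p) :
    𝔼 τ : Equiv.Perm (Fin p), f (τ k) = (∑ j, f j) / p := by
  have hp : (p : ℝ) ≠ 0 := by
    have := k.pos
    positivity
  have hsymm : ∀ j, 𝔼 τ : Equiv.Perm (Fin p), f (τ j) = 𝔼 τ : Equiv.Perm (Fin p), f (τ k) :=
    fun j => Fintype.expect_equiv (Equiv.mulRight (Equiv.swap j k)) _ _ fun τ => by simp
  rw [eq_div_iff hp]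
  calc (𝔼 τ : Equiv.Perm (Fin p), f (τ k)) * p
      = ∑ j, 𝔼 τ : Equiv.Perm (Fin p), f (τ j) := by simp [hsymm, mul_comm]
    _ = 𝔼 τ : Equiv.Perm (Fin p), ∑ j, f (τ j) := Finset.expect_sum_comm _ _ _ |>.symm
    _ = 𝔼 τ : Equiv.Perm (Fin p), ∑ j, f j := by
        simp_rw [Equiv.sum_comp]
    _ = ∑ j, f j := by simp

theorem minHash_eq_iff {p : ℕ} (τ : Equiv.Perm (Fin p)) (z : Finset (Fin p)) (hz : z.Nonempty)
    (k : Fin p) : minHash τ z hz = k ↔ k ∈ z ∧ ∀ j ∈ z, τ k ≤ τ j := by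
  constructor
  · rintro rfl
    exact ⟨minHash_mem τ z hz, fun j hj => apply_minHash_le τ z hz hj⟩
  · rintro ⟨hk, h⟩
    exact τ.injective (le_antisymm (apply_minHash_le τ z hz hk) (h _ (minHash_mem τ z hz)))

theorem minHash_mul {p : ℕ} (τ e : Equiv.Perm (Fin p)) (z z' : Finset (Fin p)) (hz : z.Nonempty)
    (hz' : z'.Nonempty) (h : ∀ k, k ∈ z ↔ e k ∈ z') :
    minHash τ z' hz' = e (minHash (τ * e) z hz) := by
  rw [minHash_eq_iff]
  refine ⟨(h _).1 (minHash_mem _ _ _), fun j hj => ?_⟩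
  have := apply_minHash_le (τ * e) z hz (k := e.symm j) ((h _).2 (by simpa using hj))
  simpa using this

/-- The distribution of the rank of the hashed variable depends on the active set only through its
size. -/
theorem expect_rank_minHash_congr {p : ℕ} (f : Fin p → ℝ) (z z' : Finset (Fin p))
    (hz : z.Nonempty) (hz' : z'.Nonempty) (hcard : z.card = z'.card) :
    𝔼 τ : Equiv.Perm (Fin p), f (τ (minHash τ z hz)) =
      𝔼 τ : Equiv.Perm (Fin p), f (τ (minHash τ z' hz')) := by
  let e₀ : {x // x ∈ z} ≃ {x // x ∈ z'} := Finset.equivOfCardEq hcard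
  let e : Equiv.Perm (Fin p) := e₀.extendSubtype
  have he : ∀ k, k ∈ z ↔ e k ∈ z' := fun k =>
    ⟨fun hk => e₀.extendSubtype_mem k hk, fun hk => by
      by_contra hk'
      exact e₀.extendSubtype_not_mem k hk' hk⟩
  symm
  refine Fintype.expect_equiv (Equiv.mulRight e) _ _ fun τ => ?_
  rw [minHash_mul τ e z z' hz hz' he]
  simp

/-- Given the rank of the hashed variable, every active variable is equally likely to be the hashed
one. -/
theorem expect_ite_minHash_eq {p : ℕ} (f : Fin p → ℝ) (z : Finset (Fin p)) (hz : z.Nonempty)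
    {k : Fin p} (hk : k ∈ z) :
    𝔼 τ : Equiv.Perm (Fin p), (if minHash τ z hz = k then f (τ k) else 0) =
      (𝔼 τ : Equiv.Perm (Fin p), f (τ (minHash τ z hz))) / z.card := by
  have hc : (z.card : ℝ) ≠ 0 := by
    have := hz.card_pos
    positivity
  have hsymm : ∀ j ∈ z, 𝔼 τ : Equiv.Perm (Fin p), (if minHash τ z hz = j then f (τ j) else 0) =
      𝔼 τ : Equiv.Perm (Fin p), (if minHash τ z hz = k then f (τ k) else 0) := fun j hj => by
    refine Fintype.expect_equiv (Equiv.mulRight (Equiv.swap j k)) _ _ fun τ => ?_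
    have hmem : ∀ i, i ∈ z ↔ Equiv.swap j k i ∈ z := fun i => by
      rcases eq_or_ne i j with rfl | hij
      · simp [hj, hk]
      rcases eq_or_ne i k with rfl | hik
      · simp [hj, hk]
      rw [Equiv.swap_apply_of_ne_of_ne hij hik]
    rw [minHash_mul τ (Equiv.swap j k) z z hz hz hmem]
    simp [Equiv.swap_apply_eq_iff]
  rw [eq_div_iff hc]
  calc _ = ∑ j ∈ z, 𝔼 τ : Equiv.Perm (Fin p), (if minHash τ z hz = j then f (τ j) else 0) := by
        rw [Finset.sum_congr rfl hsymm]
        simp [mul_comm]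
    _ = 𝔼 τ : Equiv.Perm (Fin p), ∑ j ∈ z, (if minHash τ z hz = j then f (τ j) else 0) :=
        (Finset.expect_sum_comm _ _ _).symm
    _ = _ := by
        refine Finset.expect_congr rfl fun τ _ => ?_
        rw [Finset.sum_ite_eq, if_pos (minHash_mem τ z hz)]

/-- The hazard rate of the smallest rank of an active variable is at least `q / p`: conditionally on
all active variables having rank at least `l`, every rank from `l` on is equally likely to be
occupied by an active variable. -/
theorem card_mul_card_le_rank_minHash {p : ℕ} (z : Finset (Fin p)) (hz : z.Nonempty) (l : Fin p) :
    z.card * (Finset.univ.filter fun τ : Equiv.Perm (Fin p) => l ≤ τ (minHash τ z hz)).card ≤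
      p * (Finset.univ.filter fun τ : Equiv.Perm (Fin p) => τ (minHash τ z hz) = l).card := by
  have hiff : ∀ τ : Equiv.Perm (Fin p), l ≤ τ (minHash τ z hz) ↔ ∀ k ∈ z, l ≤ τ k := fun τ =>
    ⟨fun h k hk => h.trans (apply_minHash_le τ z hz hk), fun h => h _ (minHash_mem τ z hz)⟩
  have hle : ∀ j : Fin p,
      (Finset.univ.filter fun τ : Equiv.Perm (Fin p) =>
        l ≤ τ (minHash τ z hz) ∧ τ.symm j ∈ z).card ≤
      (Finset.univ.filter fun τ : Equiv.Perm (Fin p) => τ (minHash τ z hz) = l).card := fun j => by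
    refine Finset.card_le_card_of_injOn (fun τ => Equiv.swap j l * τ) ?_
      (mul_right_injective _).injOn
    intro τ hτ
    simp only [Finset.coe_filter, Finset.mem_univ, true_and, Set.mem_ofPred_eq] at hτ ⊢
    obtain ⟨h1, h2⟩ := hτ
    rw [hiff] at h1
    have hjl : l ≤ j := by simpa using h1 _ h2
    have : minHash (Equiv.swap j l * τ) z hz = τ.symm j := by
      rw [minHash_eq_iff]
      refine ⟨h2, fun k hk => ?_⟩
      have hk' := h1 k hk
      simp only [Equiv.Perm.coe_mul, Function.comp_apply, Equiv.apply_symm_apply,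
        Equiv.swap_apply_left]
      rcases eq_or_ne (τ k) j with h | h
      · rw [h, Equiv.swap_apply_left]
      rcases eq_or_ne (τ k) l with h' | h'
      · rwa [h', Equiv.swap_apply_right]
      rwa [Equiv.swap_apply_of_ne_of_ne h h']
    simp [this]
  calc z.card * (Finset.univ.filter fun τ : Equiv.Perm (Fin p) => l ≤ τ (minHash τ z hz)).card
      = ∑ τ ∈ Finset.univ.filter fun τ : Equiv.Perm (Fin p) => l ≤ τ (minHash τ z hz),
          (Finset.univ.filter fun j => τ.symm j ∈ z).card := by
        rw [Finset.sum_congr rfl (g := fun _ => z.card), Finset.sum_const, smul_eq_mul, mul_comm]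
        intro τ _
        rw [← Finset.card_map τ.symm.toEmbedding]
        congr 1
        ext j
        simp
    _ = ∑ j, (Finset.univ.filter fun τ : Equiv.Perm (Fin p) =>
          l ≤ τ (minHash τ z hz) ∧ τ.symm j ∈ z).card := by
        simp_rw [Finset.card_filter (fun _ : Fin p => _)]
        rw [Finset.sum_comm]
        refine Finset.sum_congr rfl fun j _ => ?_
        rw [← Finset.filter_filter, Finset.card_filter]
    _ ≤ _ := by
        refine (Finset.sum_le_sum fun j _ => hle j).trans ?_
        simp

/-- The smallest rank of an active variable is stochastically smaller than a geometric variable of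
parameter `δ = q / p`, for which the expectation of `(1 - δ) ^ rank` is `1 / (2 - δ)`. -/
theorem le_expect_pow_rank_minHash {p q : ℕ} (z : Finset (Fin p)) (hz : z.Nonempty)
    (hq : z.card = q) :
    1 / (2 - (q : ℝ) / p) ≤
      𝔼 τ : Equiv.Perm (Fin p), (1 - (q : ℝ) / p) ^ (τ (minHash τ z hz) : ℕ) := by
  have hp : 0 < p := hz.choose.pos
  have hqp : q ≤ p := by simpa [hq] using z.card_le_univ
  set δ : ℝ := (q : ℝ) / p with hδ
  have hδ0 : 0 ≤ δ := by positivity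
  have hδ1 : δ ≤ 1 := div_le_one_of_le₀ (by exact_mod_cast hqp) (by positivity)
  set a : ℝ := 1 / (2 - δ) with ha
  have ha' : a * (2 - δ) = 1 := by rw [ha]; field_simp [show (2 - δ) ≠ 0 by linarith]
  have ha0 : 0 ≤ a := by rw [ha]; apply div_nonneg <;> linarith
  have har : a * (1 - δ) ≤ 1 := by nlinarith
  let m : Equiv.Perm (Fin p) → ℕ := fun τ => (τ (minHash τ z hz) : ℕ)
  let G : ℕ → ℝ := fun l => ((Finset.univ.filter fun τ => l ≤ m τ).card : ℝ)
  -- descending induction on the smallest rank allowed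
  have key : ∀ d l : ℕ, l + d = p →
      a * (1 - δ) ^ l * G l ≤ ∑ τ ∈ Finset.univ.filter (fun τ => l ≤ m τ), (1 - δ) ^ m τ := by
    intro d
    induction d with
    | zero =>
      intro l hl
      have : (Finset.univ.filter fun τ => l ≤ m τ) = ∅ := by
        refine Finset.filter_eq_empty_iff.2 fun τ _ => ?_
        have := (τ (minHash τ z hz)).2
        simp only [m]; omega
      simp [G, this]
    | succ d ih =>
      intro l hl
      have hlp : l < p := by omega
      have hsplit : (Finset.univ.filter fun τ => l ≤ m τ) =
          (Finset.univ.filter fun τ => m τ = l) ∪ (Finset.univ.filter fun τ => l + 1 ≤ m τ) := by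
        ext τ; simp; omega
      have hdisj : Disjoint (Finset.univ.filter fun τ => m τ = l)
          (Finset.univ.filter fun τ => l + 1 ≤ m τ) := by
        rw [Finset.disjoint_filter]; intro τ _ h; omega
      set E : ℝ := ((Finset.univ.filter fun τ => m τ = l).card : ℝ) with hE
      have hG : G l = E + G (l + 1) := by
        simp only [G, hE]
        rw [hsplit, Finset.card_union_of_disjoint hdisj]; push_cast; rfl
      have hhaz : δ * G l ≤ E := by
        have h := card_mul_card_le_rank_minHash z hz ⟨l, hlp⟩
        simp only [Fin.le_def, Fin.ext_iff, hq] at h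
        have h' := (Nat.cast_le (α := ℝ)).2 h
        push_cast at h'
        change (q : ℝ) * G l ≤ p * E at h'
        rw [hδ, div_mul_eq_mul_div, div_le_iff₀ (by positivity)]
        linarith
      have hrl : 0 ≤ (1 - δ) ^ l := pow_nonneg (by linarith) _
      rw [hsplit, Finset.sum_union hdisj]
      have h1 : ∑ τ ∈ Finset.univ.filter (fun τ => m τ = l), (1 - δ) ^ m τ = (1 - δ) ^ l * E := by
        rw [Finset.sum_congr rfl (g := fun _ => (1 - δ) ^ l)]
        · simp [hE, mul_comm]
        · intro τ hτ; rw [(Finset.mem_filter.1 hτ).2]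
      have h2 := ih (l + 1) (by omega)
      rw [h1]
      refine le_trans ?_ (add_le_add_right h2 _)
      have hcore : a * G l ≤ E + a * (1 - δ) * G (l + 1) := by
        have : G (l + 1) = G l - E := by linarith
        rw [this]
        have h3 : 0 ≤ (1 - a * (1 - δ)) * (E - δ * G l) :=
          mul_nonneg (by linarith) (by linarith)
        have h4 : a * G l = δ * (1 - a * (1 - δ)) * G l + a * (1 - δ) * G l := by
          linear_combination (δ * G l) * ha'
        nlinarith
      calc a * (1 - δ) ^ l * G l = (1 - δ) ^ l * (a * G l) := by ring
        _ ≤ (1 - δ) ^ l * (E + a * (1 - δ) * G (l + 1)) := mul_le_mul_of_nonneg_left hcore hrl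
        _ = _ := by ring
  have h0 := key p 0 (by simp)
  rw [Fintype.expect_eq_sum_div_card, le_div_iff₀ (by positivity)]
  simpa [G] using h0

/-! ### Random signs and their exponential moments -/

theorem expect_prod_pi {ι κ : Type*} [Fintype ι] [DecidableEq ι] [Fintype κ]
    (f : ι → κ → ℝ) : 𝔼 x : ι → κ, ∏ i, f i (x i) = ∏ i, 𝔼 k, f i k := by
  simp_rw [Fintype.expect_eq_sum_div_card]
  rw [Finset.prod_div_distrib, Finset.prod_univ_sum, Fintype.piFinset_univ]
  simp

theorem expect_sign_mul_sign {p : ℕ} (j k : Fin p) :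
    𝔼 ψ : Fin p → ℤˣ, ((ψ j : ℤ) : ℝ) * ((ψ k : ℤ) : ℝ) = if j = k then 1 else 0 := by
  split_ifs with h
  · subst h
    rw [Finset.expect_congr rfl (g := fun _ => (1 : ℝ))]
    · simp
    · intro ψ _
      rcases Int.units_eq_one_or (ψ j) with h | h <;> simp [h]
  · -- flipping the sign of variable `j` changes the sign of the product
    have h1 : 𝔼 ψ : Fin p → ℤˣ, ((ψ j : ℤ) : ℝ) * ((ψ k : ℤ) : ℝ) =
        𝔼 ψ : Fin p → ℤˣ, -(((ψ j : ℤ) : ℝ) * ((ψ k : ℤ) : ℝ)) := by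
      refine Fintype.expect_equiv (Equiv.mulLeft (Pi.mulSingle j (-1))) _ _ fun ψ => ?_
      simp [Pi.mulSingle_eq_of_ne (Ne.symm h)]
    rw [Finset.expect_neg_distrib] at h1
    linarith

theorem expect_sign_mul_sum {p : ℕ} (a : Fin p → ℝ) (j : Fin p) :
    𝔼 ψ : Fin p → ℤˣ, ((ψ j : ℤ) : ℝ) * ∑ k, a k * ((ψ k : ℤ) : ℝ) = a j := by
  calc _ = ∑ k, a k * 𝔼 ψ : Fin p → ℤˣ, ((ψ j : ℤ) : ℝ) * ((ψ k : ℤ) : ℝ) := by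
        simp_rw [Finset.mul_expect]
        rw [← Finset.expect_sum_comm]
        refine Finset.expect_congr rfl fun ψ _ => ?_
        rw [Finset.mul_sum]
        exact Finset.sum_congr rfl fun k _ => by ring
    _ = a j := by simp [expect_sign_mul_sign]

theorem expect_sum_sign_sq {p : ℕ} (a : Fin p → ℝ) :
    𝔼 ψ : Fin p → ℤˣ, (∑ k, a k * ((ψ k : ℤ) : ℝ)) ^ 2 = ∑ k, a k ^ 2 := by
  calc _ = ∑ j, a j * 𝔼 ψ : Fin p → ℤˣ, ((ψ j : ℤ) : ℝ) * ∑ k, a k * ((ψ k : ℤ) : ℝ) := by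
        simp_rw [Finset.mul_expect]
        rw [← Finset.expect_sum_comm]
        refine Finset.expect_congr rfl fun ψ _ => ?_
        rw [sq, Finset.sum_mul]
        exact Finset.sum_congr rfl fun k _ => by ring
    _ = _ := by simp_rw [expect_sign_mul_sum, sq]

theorem expect_exp_sum_sign_le {p : ℕ} (a : Fin p → ℝ) (x : ℝ) :
    𝔼 ψ : Fin p → ℤˣ, Real.exp (x * ∑ k, a k * ((ψ k : ℤ) : ℝ)) ≤
      Real.exp (x ^ 2 * (∑ k, a k ^ 2) / 2) := by
  calc _ = 𝔼 ψ : Fin p → ℤˣ, ∏ k, Real.exp (x * a k * ((ψ k : ℤ) : ℝ)) := by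
        refine Finset.expect_congr rfl fun ψ _ => ?_
        rw [← Real.exp_sum, Finset.mul_sum]
        simp_rw [mul_assoc]
    _ = ∏ k, 𝔼 u : ℤˣ, Real.exp (x * a k * ((u : ℤ) : ℝ)) :=
        expect_prod_pi fun k (u : ℤˣ) => Real.exp (x * a k * ((u : ℤ) : ℝ))
    _ = ∏ k, Real.cosh (x * a k) := by
        refine Finset.prod_congr rfl fun k _ => ?_
        rw [Fintype.expect_eq_sum_div_card, UnitsInt.univ, Real.cosh_eq]
        simp
    _ ≤ ∏ k, Real.exp ((x * a k) ^ 2 / 2) :=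
        Finset.prod_le_prod (fun k _ => (Real.cosh_pos _).le)
          fun k _ => Real.cosh_le_exp_half_sq _
    _ = _ := by
        rw [← Real.exp_sum, Finset.mul_sum, Finset.sum_div]
        simp_rw [mul_pow]

/-- Linearisation of the exponential of a square by a Gaussian integral. -/
theorem integral_exp_neg_sq_add_mul (y : ℝ) :
    ∫ x : ℝ, Real.exp (-x ^ 2 + 2 * y * x) = √Real.pi * Real.exp (y ^ 2) := by
  have h : ∀ x : ℝ, Real.exp (-x ^ 2 + 2 * y * x) =
      Real.exp (-1 * (x - y) ^ 2) * Real.exp (y ^ 2) := fun x => by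
    rw [← Real.exp_add]; ring_nf
  simp_rw [h]
  rw [integral_mul_const, integral_sub_right_eq_self fun x => Real.exp (-1 * x ^ 2),
    integral_gaussian, div_one]

theorem integrable_exp_neg_sq_add_mul (y : ℝ) :
    Integrable fun x : ℝ => Real.exp (-x ^ 2 + 2 * y * x) := by
  have h : ∀ x : ℝ, Real.exp (-x ^ 2 + 2 * y * x) =
      Real.exp (-1 * (x - y) ^ 2) * Real.exp (y ^ 2) := fun x => by
    rw [← Real.exp_add]; ring_nf
  simp_rw [h]
  exact ((integrable_exp_neg_mul_sq one_pos).comp_sub_right y).mul_const _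

/-- The square of a Rademacher sum has the exponential moments of the square of a Gaussian variable
of the same variance, as an upper bound. -/
theorem expect_exp_mul_sum_sign_sq_le {p : ℕ} (a : Fin p → ℝ) {s : ℝ} (hs : 0 ≤ s)
    (hlt : 2 * s * ∑ k, a k ^ 2 < 1) :
    𝔼 ψ : Fin p → ℤˣ, Real.exp (s * (∑ k, a k * ((ψ k : ℤ) : ℝ)) ^ 2) ≤
      1 / √(1 - 2 * s * ∑ k, a k ^ 2) := by
  set v := ∑ k, a k ^ 2 with hv
  let g : (Fin p → ℤˣ) → ℝ := fun ψ => ∑ k, a k * ((ψ k : ℤ) : ℝ)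
  have hpi : 0 < √Real.pi := Real.sqrt_pos.2 Real.pi_pos
  have hint : ∀ ψ, Integrable fun x : ℝ => Real.exp (-x ^ 2 + 2 * (√s * g ψ) * x) :=
    fun ψ => integrable_exp_neg_sq_add_mul _
  have key : √Real.pi * 𝔼 ψ, Real.exp (s * g ψ ^ 2) ≤ √Real.pi * (1 / √(1 - 2 * s * v)) := by
    calc √Real.pi * 𝔼 ψ, Real.exp (s * g ψ ^ 2)
        = 𝔼 ψ, ∫ x : ℝ, Real.exp (-x ^ 2 + 2 * (√s * g ψ) * x) := by
          simp_rw [integral_exp_neg_sq_add_mul, mul_pow, Real.sq_sqrt hs]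
          rw [Finset.mul_expect]
      _ = ∫ x : ℝ, 𝔼 ψ, Real.exp (-x ^ 2 + 2 * (√s * g ψ) * x) := by
          simp_rw [Fintype.expect_eq_sum_div_card]
          rw [integral_div, integral_finsetSum _ fun ψ _ => hint ψ]
      _ ≤ ∫ x : ℝ, Real.exp (-(1 - 2 * s * v) * x ^ 2) := by
          refine integral_mono ?_ (integrable_exp_neg_mul_sq (by linarith)) fun x => ?_
          · simp_rw [Fintype.expect_eq_sum_div_card]
            exact (integrable_finsetSum _ fun ψ _ => hint ψ).div_const _
          · have h1 := expect_exp_sum_sign_le a (2 * √s * x)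
            have h2 : ∀ ψ, Real.exp (-x ^ 2 + 2 * (√s * g ψ) * x) =
                Real.exp (-x ^ 2) * Real.exp ((2 * √s * x) * g ψ) := fun ψ => by
              rw [← Real.exp_add]; ring_nf
            simp_rw [h2]
            rw [← Finset.mul_expect]
            refine (mul_le_mul_of_nonneg_left h1 (Real.exp_pos _).le).trans_eq ?_
            rw [← Real.exp_add, mul_pow, mul_pow, Real.sq_sqrt hs, ← hv]
            ring_nf
      _ = √Real.pi * (1 / √(1 - 2 * s * v)) := by
          rw [integral_gaussian, Real.sqrt_div Real.pi_pos.le]; ring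
  exact le_of_mul_le_mul_left key hpi

theorem one_div_sqrt_one_sub_le {x : ℝ} (hx1 : x < 1) (hx0 : 0 ≤ x) :
    1 / √(1 - x) ≤ 1 + x / 2 + 3 / 8 * x ^ 2 / (1 - x) := by
  obtain ⟨y, hy⟩ : ∃ y, y = √(1 - x) := ⟨_, rfl⟩
  have hy0 : 0 < y := hy ▸ Real.sqrt_pos.2 (by linarith)
  have hyx : 1 - x = y ^ 2 := by rw [hy, Real.sq_sqrt (by linarith)]
  have hy1 : y ≤ 1 := by nlinarith
  rw [← hy, hyx, show x = 1 - y ^ 2 by linarith, ← sub_nonneg]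
  have : 1 + (1 - y ^ 2) / 2 + 3 / 8 * (1 - y ^ 2) ^ 2 / y ^ 2 - 1 / y =
      (1 - y) ^ 3 * (3 + y) / (8 * y ^ 2) := by
    field_simp
    ring
  rw [this]
  exact div_nonneg (mul_nonneg (pow_nonneg (by linarith) 3) (by linarith)) (by positivity)

/-- An upper bound on the exponential moments of the square of a Rademacher sum that is linear in
the variance of the sum, so that it can be averaged over random coefficients. -/
theorem expect_exp_mul_sum_sign_sq_le_linear {p : ℕ} (a : Fin p → ℝ) {s M : ℝ} (hs : 0 ≤ s)
    (hM : 0 < M) (haM : ∑ k, a k ^ 2 ≤ M) (hlt : 2 * s * M < 1) :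
    𝔼 ψ : Fin p → ℤˣ, Real.exp (s * (∑ k, a k * ((ψ k : ℤ) : ℝ)) ^ 2) ≤
      1 + (∑ k, a k ^ 2) * (s + 3 / 2 * s ^ 2 * M / (1 - 2 * s * M)) := by
  set v := ∑ k, a k ^ 2 with hv
  have hv0 : 0 ≤ v := Finset.sum_nonneg fun _ _ => sq_nonneg _
  have hvM : 2 * s * v ≤ 2 * s * M := mul_le_mul_of_nonneg_left haM (by linarith)
  refine (expect_exp_mul_sum_sign_sq_le a hs (by linarith)).trans ?_
  rw [← hv]
  refine (one_div_sqrt_one_sub_le (by linarith) (by positivity)).trans ?_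
  have h1 : 3 / 8 * (2 * s * v) ^ 2 / (1 - 2 * s * v) ≤
      v * (3 / 2 * s ^ 2 * M / (1 - 2 * s * M)) := by
    rw [← mul_div_assoc]
    refine div_le_div₀ (by positivity) ?_ (by linarith) (by linarith)
    calc 3 / 8 * (2 * s * v) ^ 2 = 3 / 2 * s ^ 2 * v * v := by ring
      _ ≤ 3 / 2 * s ^ 2 * v * M := mul_le_mul_of_nonneg_left haM (by positivity)
      _ = _ := by ring
  linarith

/-! ### The approximation by a single column -/

theorem l2norm_sq {ι : Type*} [Fintype ι] (v : ι → ℝ) : l2norm v ^ 2 = ∑ i, v i ^ 2 := by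
  simp [l2norm, EuclideanSpace.norm_sq_eq]

theorem l2norm_nonneg {ι : Type*} [Fintype ι] (v : ι → ℝ) : 0 ≤ l2norm v := norm_nonneg _

/-- Weights of the ranks that make the coefficients of the compressed regression unbiased. They
decrease geometrically in the rank. -/
theorem exists_rank_weights {p q : ℕ} (hq : 1 ≤ q) (hqp : q ≤ p) :
    ∃ w : Fin p → ℝ,
      (∀ (z : Finset (Fin p)) (hz : z.Nonempty), z.card = q →
        𝔼 τ : Equiv.Perm (Fin p), w (τ (minHash τ z hz)) = 1) ∧
      (∀ j, |w j| ≤ 2 - (q : ℝ) / p) ∧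
      q * ((∑ j, w j ^ 2) / p) ≤ 2 - (q : ℝ) / p := by
  have hp : 0 < (p : ℝ) := by exact_mod_cast (by omega : 0 < p)
  have hq0 : 0 < (q : ℝ) := by exact_mod_cast (by omega : 0 < q)
  obtain ⟨z₀, -, hz₀⟩ := Finset.exists_subset_card_eq
    (s := (Finset.univ : Finset (Fin p))) (n := q) (by simpa using hqp)
  have hne : z₀.Nonempty := Finset.card_pos.1 (by omega)
  have hlow := le_expect_pow_rank_minHash z₀ hne hz₀
  set δ : ℝ := (q : ℝ) / p with hδ
  have hδ0 : 0 < δ := by positivity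
  have hδ1 : δ ≤ 1 := div_le_one_of_le₀ (by exact_mod_cast hqp) (by positivity)
  obtain ⟨e, he⟩ : ∃ e, e = 𝔼 τ : Equiv.Perm (Fin p), (1 - δ) ^ (τ (minHash τ z₀ hne) : ℕ) :=
    ⟨_, rfl⟩
  rw [← he] at hlow
  have he0 : 0 < e := lt_of_lt_of_le (one_div_pos.2 (by linarith)) hlow
  have he1 : 1 / e ≤ 2 - δ := by
    rw [div_le_iff₀ (by linarith)] at hlow
    rw [div_le_iff₀ he0]
    linarith
  refine ⟨fun j => (1 - δ) ^ (j : ℕ) / e, fun z hz hzq => ?_, fun j => ?_, ?_⟩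
  · rw [← expect_rank_minHash_congr (fun j : Fin p => (1 - δ) ^ (j : ℕ) / e) z₀ z hne hz
      (hz₀.trans hzq.symm), ← Finset.expect_div, ← he, div_self he0.ne']
  · have h0 : 0 ≤ (1 - δ) ^ (j : ℕ) := pow_nonneg (by linarith) _
    rw [abs_of_nonneg (by positivity)]
    refine le_trans ?_ he1
    exact div_le_div_of_nonneg_right (pow_le_one₀ (by linarith) (by linarith)) he0.le
  · have hgeom : (∑ j : Fin p, ((1 - δ) ^ (j : ℕ)) ^ 2) * (δ * (2 - δ)) ≤ 1 := by
      have h1 : ∑ j : Fin p, ((1 - δ) ^ (j : ℕ)) ^ 2 =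
          ∑ j ∈ Finset.range p, ((1 - δ) ^ 2) ^ j := by
        rw [← Fin.sum_univ_eq_sum_range (fun j => ((1 - δ) ^ 2) ^ j)]
        exact Finset.sum_congr rfl fun j _ => by rw [← pow_mul, ← pow_mul, mul_comm]
      have h2 := geom_sum_mul ((1 - δ) ^ 2) p
      have h3 : 0 ≤ ((1 - δ) ^ 2) ^ p := by positivity
      rw [h1]
      nlinarith
    have hs : ∑ j : Fin p, ((1 - δ) ^ (j : ℕ) / e) ^ 2 =
        (1 / e) ^ 2 * ∑ j : Fin p, ((1 - δ) ^ (j : ℕ)) ^ 2 := by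
      rw [Finset.mul_sum]
      exact Finset.sum_congr rfl fun j _ => by ring
    rw [hs, show (q : ℝ) * ((1 / e) ^ 2 * (∑ j : Fin p, ((1 - δ) ^ (j : ℕ)) ^ 2) / p) =
      (1 / e) ^ 2 * (δ * ∑ j : Fin p, ((1 - δ) ^ (j : ℕ)) ^ 2) by rw [hδ]; ring]
    set A := ∑ j : Fin p, ((1 - δ) ^ (j : ℕ)) ^ 2 with hA
    have hA0 : 0 ≤ A := Finset.sum_nonneg fun _ _ => sq_nonneg _
    have hsq : (1 / e) ^ 2 ≤ (2 - δ) ^ 2 := by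
      have : 0 < 1 / e := by positivity
      gcongr
    have h2δ : 0 < 2 - δ := by linarith
    calc (1 / e) ^ 2 * (δ * A) ≤ (2 - δ) ^ 2 * (δ * A) := by gcongr
      _ = (2 - δ) * (A * (δ * (2 - δ))) := by ring
      _ ≤ (2 - δ) * 1 := by gcongr
      _ = 2 - δ := mul_one _

/-- The randomness of a single column of the compressed matrix: a permutation of the variables and
one sign for each variable. -/
abbrev HashColumn (p : ℕ) : Type := Equiv.Perm (Fin p) × (Fin p → ℤˣ)

open Classical in
/-- The entry in row `i` of a compressed column. -/
noncomputable def hashEntry {n p : ℕ} (X : Matrix (Fin n) (Fin p) ℝ) (i : Fin n)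
    (c : HashColumn p) : ℝ :=
  if hz : (activeSet X i).Nonempty then
    (((c.2 (minHash c.1 (activeSet X i) hz) : ℤˣ) : ℤ) : ℝ) *
      X i (minHash c.1 (activeSet X i) hz)
  else 0

/-- The unnormalised coefficient of a compressed column in the approximation of `X β`: the sum of
the coefficients `β`, with the signs of the column and the weights `w` of the ranks. -/
noncomputable def hashCoef {p : ℕ} (w β : Fin p → ℝ) (c : HashColumn p) : ℝ :=
  ∑ k, β k * w (c.1 k) * ((c.2 k : ℤ) : ℝ)

theorem mem_activeSet {n p : ℕ} (X : Matrix (Fin n) (Fin p) ℝ) (i : Fin n) (k : Fin p) :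
    k ∈ activeSet X i ↔ X i k ≠ 0 := by
  simp [activeSet]

theorem abs_hashEntry_le {n p : ℕ} (X : Matrix (Fin n) (Fin p) ℝ) (hX : ∀ i k, |X i k| ≤ 1)
    (i : Fin n) (c : HashColumn p) : |hashEntry X i c| ≤ 1 := by
  unfold hashEntry
  split_ifs with hz
  · rw [abs_mul]
    rcases Int.units_eq_one_or (c.2 (minHash c.1 (activeSet X i) hz)) with h | h <;>
      simp [h, hX]
  · simp

theorem expect_hashColumn {p : ℕ} (f : HashColumn p → ℝ) :
    𝔼 c, f c = 𝔼 τ : Equiv.Perm (Fin p), 𝔼 ψ : Fin p → ℤˣ, f (τ, ψ) := by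
  rw [← Finset.univ_product_univ, Finset.expect_product]

/-- A compressed column times its coefficient is an unbiased estimate of the linear predictor. -/
theorem expect_hashEntry_mul_hashCoef {n p q : ℕ} (hq : 1 ≤ q) (X : Matrix (Fin n) (Fin p) ℝ)
    (hXq : ∀ i, (activeSet X i).card = q) (β w : Fin p → ℝ)
    (hw : ∀ (z : Finset (Fin p)) (hz : z.Nonempty), z.card = q →
        𝔼 τ : Equiv.Perm (Fin p), w (τ (minHash τ z hz)) = 1) (i : Fin n) :
    𝔼 c : HashColumn p, hashEntry X i c * (q * hashCoef w β c) = (X *ᵥ β) i := by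
  have hz : (activeSet X i).Nonempty := Finset.card_pos.1 (by rw [hXq i]; omega)
  have hq0 : (q : ℝ) ≠ 0 := by exact_mod_cast (by omega : q ≠ 0)
  set z := activeSet X i with hzdef
  have h1 : ∀ τ : Equiv.Perm (Fin p),
      𝔼 ψ : Fin p → ℤˣ, hashEntry X i (τ, ψ) * (q * hashCoef w β (τ, ψ)) =
        ∑ k ∈ z, q * (X i k * β k) * (if minHash τ z hz = k then w (τ k) else 0) := fun τ => by
    simp_rw [mul_ite, mul_zero]
    rw [Finset.sum_ite_eq, if_pos (minHash_mem τ z hz)]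
    have h2 := expect_sign_mul_sum (fun k => β k * w (τ k)) (minHash τ z hz)
    rw [mul_assoc, mul_assoc, ← h2, ← mul_assoc, Finset.mul_expect]
    refine Finset.expect_congr rfl fun ψ _ => ?_
    simp only [hashEntry, hashCoef, ← hzdef, dif_pos hz]
    ring
  rw [expect_hashColumn]
  simp_rw [h1]
  rw [Finset.expect_sum_comm, Matrix.mulVec, dotProduct,
    ← Finset.sum_subset (Finset.subset_univ z)]
  · refine Finset.sum_congr rfl fun k hk => ?_
    rw [← Finset.mul_expect, expect_ite_minHash_eq w z hz hk, hw z hz (hXq i), hXq i]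
    field_simp
  · intro k _ hk
    rw [hzdef, mem_activeSet, not_not] at hk
    simp [hk]

theorem expect_sum_mul_rank_sq {p : ℕ} (β w : Fin p → ℝ) :
    𝔼 τ : Equiv.Perm (Fin p), ∑ k, (β k * w (τ k)) ^ 2 =
      (∑ k, β k ^ 2) * ((∑ j, w j ^ 2) / p) := by
  rw [Finset.expect_sum_comm, Finset.sum_mul]
  refine Finset.sum_congr rfl fun k _ => ?_
  rw [← expect_perm_apply (fun j => w j ^ 2) k, Finset.mul_expect]
  simp_rw [mul_pow]

theorem expect_hashCoef_sq_le {p q : ℕ} (β w : Fin p → ℝ)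
    (hw : q * ((∑ j, w j ^ 2) / p) ≤ 2 - (q : ℝ) / p) :
    𝔼 c : HashColumn p, (q * hashCoef w β c) ^ 2 ≤ (2 - (q : ℝ) / p) * q * l2norm β ^ 2 := by
  rw [expect_hashColumn]
  have h1 : ∀ τ : Equiv.Perm (Fin p), 𝔼 ψ : Fin p → ℤˣ, (q * hashCoef w β (τ, ψ)) ^ 2 =
      q ^ 2 * ∑ k, (β k * w (τ k)) ^ 2 := fun τ => by
    rw [← expect_sum_sign_sq, Finset.mul_expect]
    exact Finset.expect_congr rfl fun ψ _ => mul_pow _ _ _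
  simp_rw [h1]
  rw [← Finset.mul_expect, expect_sum_mul_rank_sq, l2norm_sq]
  have hβ : 0 ≤ ∑ k, β k ^ 2 := Finset.sum_nonneg fun _ _ => sq_nonneg _
  calc _ = (q * ((∑ j, w j ^ 2) / p)) * (q * ∑ k, β k ^ 2) := by ring
    _ ≤ (2 - (q : ℝ) / p) * (q * ∑ k, β k ^ 2) := by gcongr
    _ = _ := by ring

/-- A Bernstein-type bound on the exponential moments of the squared coefficient of a column,
normalised by the bound on its mean. -/
theorem expect_exp_hashCoef_sq_le {p q : ℕ} (hq : 1 ≤ q) (hqp : q ≤ p) (β w : Fin p → ℝ)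
    (hwb : ∀ j, |w j| ≤ 2 - (q : ℝ) / p)
    (hw : q * ((∑ j, w j ^ 2) / p) ≤ 2 - (q : ℝ) / p)
    {K t : ℝ} (hK : K = (2 - (q : ℝ) / p) * q) (ht : 0 ≤ t) (hlt : 2 * t * K < 1)
    (hβ : 0 < l2norm β) :
    𝔼 c : HashColumn p, Real.exp (t * ((q * hashCoef w β c) ^ 2 / (K * l2norm β ^ 2))) ≤
      Real.exp (t + 3 / 2 * t ^ 2 * K / (1 - 2 * t * K)) := by
  have hp : 0 < (p : ℝ) := by exact_mod_cast (by omega : 0 < p)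
  have hq0 : 0 < (q : ℝ) := by exact_mod_cast (by omega : 0 < q)
  have hδ1 : (q : ℝ) / p ≤ 1 := div_le_one_of_le₀ (by exact_mod_cast hqp) (by positivity)
  set d : ℝ := 2 - (q : ℝ) / p with hd
  have hd0 : 0 < d := by linarith
  have hK0 : 0 < K := hK ▸ by positivity
  -- `M` bounds the variance of the Rademacher sum for every permutation
  set s : ℝ := t * (q ^ 2 / (K * l2norm β ^ 2)) with hs
  set M : ℝ := d ^ 2 * l2norm β ^ 2 with hM
  have hsM : s * M = t * K := by
    rw [hs, hM, hK]; field_simp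
  have hs0 : 0 ≤ s := by positivity
  have h2 : 2 * s * M < 1 := by rw [mul_assoc, hsM, ← mul_assoc]; exact hlt
  have hv : ∀ τ : Equiv.Perm (Fin p), ∑ k, (β k * w (τ k)) ^ 2 ≤ M := fun τ => by
    rw [hM, l2norm_sq, Finset.mul_sum]
    refine Finset.sum_le_sum fun k _ => ?_
    rw [mul_pow, mul_comm]
    exact mul_le_mul_of_nonneg_right (sq_le_sq.2 ((hwb _).trans (le_abs_self _))) (sq_nonneg _)
  rw [expect_hashColumn]
  have h1 : ∀ τ : Equiv.Perm (Fin p), 𝔼 ψ : Fin p → ℤˣ,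
      Real.exp (t * ((q * hashCoef w β (τ, ψ)) ^ 2 / (K * l2norm β ^ 2))) ≤
      1 + (∑ k, (β k * w (τ k)) ^ 2) * (s + 3 / 2 * s ^ 2 * M / (1 - 2 * s * M)) := fun τ => by
    refine le_trans (Finset.expect_le_expect fun ψ _ => le_of_eq ?_)
      (expect_exp_mul_sum_sign_sq_le_linear (fun k => β k * w (τ k)) hs0 (by positivity) (hv τ) h2)
    congr 1
    rw [hs, hashCoef]
    ring
  refine (Finset.expect_le_expect fun τ _ => h1 τ).trans ?_
  rw [Finset.expect_add_distrib, ← Finset.expect_mul, expect_sum_mul_rank_sq]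
  simp only [Finset.univ_nonempty, Finset.expect_const]
  have hden : 0 < 1 - 2 * s * M := by linarith
  have hden' : 0 < 1 - 2 * t * K := by linarith
  have hmean : (∑ k, β k ^ 2) * ((∑ j, w j ^ 2) / p) ≤ l2norm β ^ 2 * d / q := by
    rw [← l2norm_sq, mul_div_assoc]
    refine mul_le_mul_of_nonneg_left ?_ (sq_nonneg _)
    rw [le_div_iff₀ hq0]
    linarith
  calc _ ≤ 1 + l2norm β ^ 2 * d / q * (s + 3 / 2 * s ^ 2 * M / (1 - 2 * s * M)) := by gcongr
    _ = 1 + (l2norm β ^ 2 * d / q * s) * (1 + 3 / 2 * (s * M) / (1 - 2 * (s * M))) := by ring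
    _ = 1 + t * (1 + 3 / 2 * (t * K) / (1 - 2 * (t * K))) := by
        rw [hsM]
        congr 2
        rw [hs, hK]; field_simp
    _ = (t + 3 / 2 * t ^ 2 * K / (1 - 2 * t * K)) + 1 := by ring
    _ ≤ _ := Real.add_one_le_exp _

/-! ### Independent columns -/

theorem expect_pi_apply {α : Type*} [Fintype α] [Nonempty α] {L : ℕ} (g : α → ℝ) (l : Fin L) :
    𝔼 f : Fin L → α, g (f l) = 𝔼 c, g c := by
  have h := expect_prod_pi fun (i : Fin L) (c : α) => if i = l then g c else 1
  rw [Finset.prod_eq_single l] at h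
  · simpa using h
  · intro i _ hi
    simp [hi]
  · simp

theorem expect_pi_apply_mul_apply {α : Type*} [Fintype α] [Nonempty α] {L : ℕ} (g : α → ℝ)
    {l m : Fin L} (hlm : l ≠ m) :
    𝔼 f : Fin L → α, g (f l) * g (f m) = (𝔼 c, g c) * 𝔼 c, g c := by
  have h := expect_prod_pi fun (i : Fin L) (c : α) => if i = l ∨ i = m then g c else 1
  have hprod : ∀ u : Fin L → ℝ, (∀ i, ¬ (i = l ∨ i = m) → u i = 1) → ∏ i, u i = u l * u m := by
    intro u hu
    rw [← Finset.prod_pair hlm]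
    refine (Finset.prod_subset (Finset.subset_univ _) fun i _ hi => hu i ?_).symm
    simpa using hi
  rw [hprod (fun i => 𝔼 c : α, if i = l ∨ i = m then g c else 1) fun i hi => by simp [hi]] at h
  simp only [true_or, or_true, if_true] at h
  rw [← h]
  refine Finset.expect_congr rfl fun f _ => ?_
  rw [hprod (fun i => if i = l ∨ i = m then g (f i) else 1) fun i hi => by simp [hi]]
  simp

/-- The variance of a sum of `L` independent copies is at most `L` times the second moment. -/
theorem expect_sum_pi_sub_sq_le {α : Type*} [Fintype α] [Nonempty α] {L : ℕ} (g : α → ℝ) :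
    𝔼 f : Fin L → α, (∑ l, g (f l) - L * 𝔼 c, g c) ^ 2 ≤ L * 𝔼 c, g c ^ 2 := by
  set μ := 𝔼 c, g c with hμ
  let h : α → ℝ := fun c => g c - μ
  have hh : 𝔼 c, h c = 0 := by
    simp only [h]
    rw [Finset.expect_sub_distrib, Finset.expect_const Finset.univ_nonempty, ← hμ, sub_self]
  have h2 : 𝔼 c, h c ^ 2 ≤ 𝔼 c, g c ^ 2 := by
    have : ∀ c, h c ^ 2 = g c ^ 2 - (2 * μ * g c - μ ^ 2) := fun c => by simp only [h]; ring
    simp_rw [this]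
    rw [Finset.expect_sub_distrib, Finset.expect_sub_distrib, ← Finset.mul_expect,
      Finset.expect_const Finset.univ_nonempty, ← hμ]
    nlinarith [sq_nonneg μ]
  calc 𝔼 f : Fin L → α, (∑ l, g (f l) - L * μ) ^ 2
      = 𝔼 f : Fin L → α, ∑ l, ∑ m, h (f l) * h (f m) := by
        refine Finset.expect_congr rfl fun f _ => ?_
        rw [← Finset.sum_mul_sum, ← sq]
        simp [h]
    _ = ∑ l : Fin L, ∑ m, if l = m then 𝔼 c, h c ^ 2 else 0 := by
        rw [Finset.expect_sum_comm]
        refine Finset.sum_congr rfl fun l _ => ?_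
        rw [Finset.expect_sum_comm]
        refine Finset.sum_congr rfl fun m _ => ?_
        split_ifs with hlm
        · subst hlm
          rw [← expect_pi_apply (fun c => h c ^ 2) l]
          simp_rw [sq]
        · rw [expect_pi_apply_mul_apply h hlm, hh, mul_zero]
    _ = L * 𝔼 c, h c ^ 2 := by simp
    _ ≤ _ := by gcongr

/-- The Chernoff bound for the sum of `L` independent copies of `Z`, under a Bernstein condition on
the exponential moments of `Z`. -/
theorem expect_indicator_lt_sum_le {α : Type*} [Fintype α] [Nonempty α] {L : ℕ} (Z : α → ℝ)
    {K η : ℝ} (hK : 0 < K) (hη : 0 < η)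
    (hZ : ∀ t, 0 ≤ t → 2 * t * K < 1 →
      𝔼 c, Real.exp (t * Z c) ≤ Real.exp (t + 3 / 2 * t ^ 2 * K / (1 - 2 * t * K))) :
    (𝔼 f : Fin L → α, if (1 + η) * L < ∑ l, Z (f l) then (1 : ℝ) else 0) ≤
      Real.exp (-(L * η ^ 2 / (2 * (3 + 2 * η) * K))) := by
  -- the usual choice of `t` in Bernstein's inequality
  obtain ⟨t, ht⟩ : ∃ t, t = η / (K * (3 + 2 * η)) := ⟨_, rfl⟩
  have ht0 : 0 ≤ t := ht ▸ by positivity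
  have h1 : 1 - 2 * t * K = 3 / (3 + 2 * η) := by rw [ht]; field_simp; ring
  have hlt : 2 * t * K < 1 := by
    have : 0 < 3 / (3 + 2 * η) := by positivity
    linarith
  have hexp := hZ t ht0 hlt
  have hexpo : t + 3 / 2 * t ^ 2 * K / (1 - 2 * t * K) =
      t * (1 + η) - η ^ 2 / (2 * (3 + 2 * η) * K) := by
    rw [h1, ht]; field_simp; ring
  rw [hexpo] at hexp
  calc (𝔼 f : Fin L → α, if (1 + η) * L < ∑ l, Z (f l) then (1 : ℝ) else 0)
      ≤ 𝔼 f : Fin L → α, Real.exp (-(t * (1 + η) * L)) * ∏ l, Real.exp (t * Z (f l)) := by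
        refine Finset.expect_le_expect fun f _ => ?_
        rw [← Real.exp_sum, ← Finset.mul_sum, ← Real.exp_add]
        split_ifs with h
        · have := mul_le_mul_of_nonneg_left h.le ht0
          refine Real.one_le_exp ?_
          linarith
        · positivity
    _ = Real.exp (-(t * (1 + η) * L)) * (𝔼 c, Real.exp (t * Z c)) ^ L := by
        rw [← Finset.mul_expect, expect_prod_pi fun (_ : Fin L) c => Real.exp (t * Z c)]
        simp
    _ ≤ Real.exp (-(t * (1 + η) * L)) *
          Real.exp (t * (1 + η) - η ^ 2 / (2 * (3 + 2 * η) * K)) ^ L := by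
        gcongr
    _ = _ := by
        rw [← Real.exp_nat_mul, ← Real.exp_add]
        congr 1; ring

/-- The seed of the hashing scheme as an independent family of columns. -/
def HashSeed.columns (p L : ℕ) : HashSeed p L ≃ (Fin L → HashColumn p) where
  toFun s := fun l => (s.perm l, fun k => s.sign k l)
  invFun f := (fun l => (f l).1, fun k l => (f l).2 k)
  left_inv _ := rfl
  right_inv _ := rfl

theorem signHash_apply {n p L : ℕ} (X : Matrix (Fin n) (Fin p) ℝ) (s : HashSeed p L) (i : Fin n)
    (l : Fin L) : signHash X s i l = hashEntry X i (HashSeed.columns p L s l) := rfl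

theorem expect_hashSeed {p L : ℕ} (F : (Fin L → HashColumn p) → ℝ) :
    𝔼 s, F (HashSeed.columns p L s) = 𝔼 f, F f :=
  Fintype.expect_equiv (HashSeed.columns p L) _ _ fun _ => rfl

/-- Approximation of the linear predictor by the compressed matrix: some random coefficients `b`
give an unbiased approximation of `X β` with small variance, and `‖b‖²` rarely exceeds the bound
imposed on the estimator. -/
theorem exists_signHash_approximation {n p q L : ℕ} (hq : 1 ≤ q) (hqp : q ≤ p) (hL : 1 ≤ L)
    (X : Matrix (Fin n) (Fin p) ℝ) (hX : ∀ i k, |X i k| ≤ 1)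
    (hXq : ∀ i, (activeSet X i).card = q) (β : Fin p → ℝ) {η : ℝ} (hη : 0 < η) :
    ∃ b : HashSeed p L → Fin L → ℝ,
      (∀ i, 𝔼 s, (signHash X s *ᵥ b s) i = (X *ᵥ β) i) ∧
      (∀ i, 𝔼 s, ((signHash X s *ᵥ b s) i - (X *ᵥ β) i) ^ 2 ≤
        (2 - (q : ℝ) / p) * q * l2norm β ^ 2 / L) ∧
      (𝔼 s, if ridgeRadiusSq p q L β η < l2norm (b s) ^ 2 then (1 : ℝ) else 0) ≤
        ridgeRho p q L η := by
  have hL0 : 0 < (L : ℝ) := by exact_mod_cast (by omega : 0 < L)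
  have hp : 0 < (p : ℝ) := by exact_mod_cast (by omega : 0 < p)
  have hq0 : 0 < (q : ℝ) := by exact_mod_cast (by omega : 0 < q)
  have hδ1 : (q : ℝ) / p ≤ 1 := div_le_one_of_le₀ (by exact_mod_cast hqp) (by positivity)
  obtain ⟨w, hw1, hwb, hw2⟩ := exists_rank_weights hq hqp
  obtain ⟨K, hK⟩ : ∃ K, K = (2 - (q : ℝ) / p) * q := ⟨_, rfl⟩
  have hK0 : 0 < K := by
    rw [hK]
    exact mul_pos (by linarith) hq0
  have hV := expect_hashCoef_sq_le β w hw2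
  rw [← hK] at hV ⊢
  let g : Fin n → HashColumn p → ℝ := fun i c => hashEntry X i c * (q * hashCoef w β c)
  have hg : ∀ i, 𝔼 c, g i c = (X *ᵥ β) i := expect_hashEntry_mul_hashCoef hq X hXq β w hw1
  let b : HashSeed p L → Fin L → ℝ := fun s l => q * hashCoef w β (HashSeed.columns p L s l) / L
  have hSb : ∀ s i, (signHash X s *ᵥ b s) i = (∑ l, g i (HashSeed.columns p L s l)) / L := by
    intro s i
    rw [Matrix.mulVec, dotProduct, Finset.sum_div]
    refine Finset.sum_congr rfl fun l _ => ?_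
    simp only [signHash_apply, b, g]
    ring
  refine ⟨b, fun i => ?_, fun i => ?_, ?_⟩
  · simp_rw [hSb]
    rw [expect_hashSeed fun f => (∑ l, g i (f l)) / L, ← Finset.expect_div, Finset.expect_sum_comm]
    simp_rw [expect_pi_apply, hg]
    simp
    field_simp
  · have h1 := expect_sum_pi_sub_sq_le (L := L) (g i)
    rw [hg] at h1
    have h2 : 𝔼 c, g i c ^ 2 ≤ K * l2norm β ^ 2 := by
      refine le_trans (Finset.expect_le_expect fun c _ => ?_) hV
      simp only [g]
      rw [mul_pow]
      exact mul_le_of_le_one_left (sq_nonneg _) ((sq_le_one_iff_abs_le_one _).2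
        (abs_hashEntry_le X hX i c))
    simp_rw [hSb]
    rw [expect_hashSeed fun f => ((∑ l, g i (f l)) / L - (X *ᵥ β) i) ^ 2]
    calc 𝔼 f : Fin L → HashColumn p, ((∑ l, g i (f l)) / L - (X *ᵥ β) i) ^ 2
        = (𝔼 f : Fin L → HashColumn p, (∑ l, g i (f l) - L * (X *ᵥ β) i) ^ 2) / L ^ 2 := by
          rw [Finset.expect_div]
          refine Finset.expect_congr rfl fun f _ => ?_
          field_simp
      _ ≤ (L * (K * l2norm β ^ 2)) / L ^ 2 := by
          gcongr
          exact h1.trans (by gcongr)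
      _ = _ := by field_simp
  · rcases (l2norm_nonneg β).eq_or_lt with hβ | hβ
    · -- for `β = 0` the coefficients vanish
      have hβ0 : ∀ k, β k = 0 := fun k => by
        have h : ∑ k, β k ^ 2 = 0 := by rw [← l2norm_sq, ← hβ]; simp
        rw [Finset.sum_eq_zero_iff_of_nonneg fun _ _ => sq_nonneg _] at h
        simpa using h k (Finset.mem_univ k)
      have hb0 : ∀ s, l2norm (b s) ^ 2 = 0 := fun s => by
        rw [l2norm_sq]
        simp [b, hashCoef, hβ0]
      simp only [hb0, ridgeRadiusSq, ← hβ]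
      simp [ridgeRho, Real.exp_nonneg]
    · have hmain := expect_indicator_lt_sum_le (L := L)
        (fun c : HashColumn p => (q * hashCoef w β c) ^ 2 / (K * l2norm β ^ 2)) hK0 hη
        fun t ht hlt => expect_exp_hashCoef_sq_le hq hqp β w hwb hw2 hK ht hlt hβ
      rw [← expect_hashSeed] at hmain
      refine le_trans (le_of_eq ?_) (hmain.trans_eq ?_)
      · refine Finset.expect_congr rfl fun s _ => ?_
        refine if_congr ?_ rfl rfl
        rw [← Finset.sum_div, lt_div_iff₀ (by positivity), l2norm_sq, ridgeRadiusSq, ← hK]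
        simp only [b, div_pow]
        rw [← Finset.sum_div, lt_div_iff₀ (by positivity),
          show (1 + η) * (K * l2norm β ^ 2 / L) * (L : ℝ) ^ 2 =
            (1 + η) * L * (K * l2norm β ^ 2) by field_simp]
      · rw [ridgeRho, hK]
        congr 2
        ring

/-! ### The constrained least squares fit -/

/-- The vector `v` with its mean subtracted from every coordinate. -/
noncomputable def center {n : ℕ} (v : Fin n → ℝ) : Fin n → ℝ := fun i => v i - vecMean v

theorem vecMean_add {n : ℕ} (u v : Fin n → ℝ) : vecMean (u + v) = vecMean u + vecMean v := by
  simp [vecMean, Finset.sum_add_distrib, add_div]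

theorem vecMean_sub {n : ℕ} (u v : Fin n → ℝ) : vecMean (u - v) = vecMean u - vecMean v := by
  simp [vecMean, Finset.sum_sub_distrib, sub_div]

theorem vecMean_const {n : ℕ} (hn : 1 ≤ n) (a : ℝ) : vecMean (fun _ : Fin n => a) = a := by
  have : (n : ℝ) ≠ 0 := by exact_mod_cast (by omega : n ≠ 0)
  simp [vecMean, this]

theorem vecMean_const_add {n : ℕ} (hn : 1 ≤ n) (a : ℝ) (v : Fin n → ℝ) :
    vecMean (fun i => a + v i) = a + vecMean v := by
  rw [← vecMean_const hn a, ← vecMean_add, vecMean_const hn]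
  rfl

theorem vecMean_eq_zero {n : ℕ} {v : Fin n → ℝ} (h : ∑ i, v i = 0) : vecMean v = 0 := by
  simp [vecMean, h]

theorem center_sub {n : ℕ} (u v : Fin n → ℝ) : center (u - v) = center u - center v := by
  ext i
  simp only [center, vecMean_sub, Pi.sub_apply]
  ring

theorem sum_sq_eq_sum_center_sq_add {n : ℕ} (hn : 1 ≤ n) (v : Fin n → ℝ) :
    ∑ i, v i ^ 2 = ∑ i, center v i ^ 2 + n * vecMean v ^ 2 := by
  have hn0 : (n : ℝ) ≠ 0 := by exact_mod_cast (by omega : n ≠ 0)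
  have hs : ∑ i, v i = n * vecMean v := by rw [vecMean]; field_simp
  have : ∀ i, center v i ^ 2 = v i ^ 2 - (2 * vecMean v * v i - vecMean v ^ 2) := fun i => by
    simp only [center]; ring
  simp_rw [this]
  rw [Finset.sum_sub_distrib, Finset.sum_sub_distrib, ← Finset.mul_sum, hs]
  simp
  ring

theorem sum_center_sq_le {n : ℕ} (hn : 1 ≤ n) (v : Fin n → ℝ) :
    ∑ i, center v i ^ 2 ≤ ∑ i, v i ^ 2 := by
  rw [sum_sq_eq_sum_center_sq_add hn v]
  have : 0 ≤ (n : ℝ) * vecMean v ^ 2 := by positivity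
  linarith

theorem l2norm_sq_convex {ι : Type*} [Fintype ι] {b b' : ι → ℝ} {r s : ℝ}
    (hb : l2norm b ^ 2 ≤ r) (hb' : l2norm b' ^ 2 ≤ r) (hs0 : 0 ≤ s) (hs1 : s ≤ 1) :
    l2norm (b + s • (b' - b)) ^ 2 ≤ r := by
  rw [l2norm_sq] at *
  calc ∑ i, (b + s • (b' - b)) i ^ 2 ≤ ∑ i, ((1 - s) * b i ^ 2 + s * b' i ^ 2) := by
        refine Finset.sum_le_sum fun i _ => ?_
        simp only [Pi.add_apply, Pi.smul_apply, Pi.sub_apply, smul_eq_mul]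
        nlinarith [mul_nonneg (mul_nonneg hs0 (sub_nonneg.2 hs1)) (sq_nonneg (b i - b' i))]
    _ = (1 - s) * ∑ i, b i ^ 2 + s * ∑ i, b' i ^ 2 := by
        rw [Finset.sum_add_distrib, Finset.mul_sum, Finset.mul_sum]
    _ ≤ (1 - s) * r + s * r := by
        have : 0 ≤ 1 - s := by linarith
        gcongr
    _ = r := by ring

/-- The variational inequality that characterises the projection onto the convex set of admissible
fits. -/
theorem IsRidgeFit.sum_mul_nonpos {n L : ℕ} {S : Matrix (Fin n) (Fin L) ℝ} {y : Fin n → ℝ}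
    {r a : ℝ} {b : Fin L → ℝ} (h : IsRidgeFit S y r a b) (a' : ℝ) {b' : Fin L → ℝ}
    (hb' : l2norm b' ^ 2 ≤ r) :
    ∑ i, (y i - fittedValues S a b i) * (fittedValues S a' b' i - fittedValues S a b i) ≤ 0 := by
  set A := ∑ i, (y i - fittedValues S a b i) *
    (fittedValues S a' b' i - fittedValues S a b i) with hA
  set B := ∑ i, (fittedValues S a' b' i - fittedValues S a b i) ^ 2 with hB
  have hB0 : 0 ≤ B := Finset.sum_nonneg fun _ _ => sq_nonneg _
  have hline : ∀ s : ℝ, 0 ≤ s → s ≤ 1 → 0 ≤ s * (s * B - 2 * A) := fun s hs0 hs1 => by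
    have h1 := h.2 (a + s * (a' - a)) (b + s • (b' - b)) (l2norm_sq_convex h.1 hb' hs0 hs1)
    rw [l2norm_sq, l2norm_sq, ← sub_nonneg, ← Finset.sum_sub_distrib] at h1
    refine h1.trans_eq ?_
    rw [hA, hB, Finset.mul_sum, Finset.mul_sum, ← Finset.sum_sub_distrib, Finset.mul_sum]
    refine Finset.sum_congr rfl fun i _ => ?_
    simp only [Pi.sub_apply, fittedValues, Matrix.mulVec_add, Matrix.mulVec_smul,
      Matrix.mulVec_sub, Pi.add_apply, Pi.smul_apply, smul_eq_mul]
    ring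
  by_contra! hpos
  -- a step towards `(a', b')` short enough to decrease the residual sum of squares
  have hs : 0 < A / (A + B) := by positivity
  have hs1 : A / (A + B) ≤ 1 := (div_le_one (by linarith)).2 (by linarith)
  have h2 := nonneg_of_mul_nonneg_right (hline _ hs.le hs1) hs
  have h3 : A / (A + B) * B ≤ A := by
    rw [div_mul_eq_mul_div, div_le_iff₀ (by linarith)]
    nlinarith
  linarith

/-- The residuals of the fit have mean zero, because the intercept is not constrained. -/
theorem IsRidgeFit.vecMean_fittedValues {n L : ℕ} {S : Matrix (Fin n) (Fin L) ℝ}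
    {y : Fin n → ℝ} {r a : ℝ} {b : Fin L → ℝ} (h : IsRidgeFit S y r a b) :
    vecMean (fittedValues S a b) = vecMean y := by
  have h1 := h.sum_mul_nonpos (a + 1) h.1
  have h2 := h.sum_mul_nonpos (a - 1) h.1
  simp only [fittedValues, add_sub_add_right_eq_sub, add_sub_cancel_left, sub_sub_cancel_left,
    ← Finset.sum_mul, Finset.sum_sub_distrib] at h1 h2
  simp only [vecMean, fittedValues]
  congr 1
  linarith

/-- The oracle inequality behind both error bounds: `b'` is any admissible coefficient vector, the
responses are `T + d + e`, and the error is measured relative to `T`. The strong convexity of the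
squared distance pays for the perturbation `d`. -/
theorem IsRidgeFit.sqError_le {n L : ℕ} (hn : 1 ≤ n) {S : Matrix (Fin n) (Fin L) ℝ}
    {y : Fin n → ℝ} {r a : ℝ} {b : Fin L → ℝ} (h : IsRidgeFit S y r a b) {T d e : Fin n → ℝ}
    (hy : y = T + d + e) (hd : ∑ i, d i = 0) {b' : Fin L → ℝ} (hb' : l2norm b' ^ 2 ≤ r) :
    sqError T S a b ≤ n * vecMean e ^ 2 + ∑ i, center (T - S *ᵥ b') i ^ 2 + ∑ i, d i ^ 2
      + 2 * ∑ i, e i * center (S *ᵥ b) i - 2 * ∑ i, e i * center (S *ᵥ b') i := by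
  have hmean := h.vecMean_fittedValues
  have ha : a + vecMean (S *ᵥ b) = vecMean y := by
    rw [← hmean, ← vecMean_const_add hn]; rfl
  set a' := vecMean y - vecMean (S *ᵥ b') with ha'
  have hvar := h.sum_mul_nonpos a' hb'
  have hTg : ∑ i, (T i - fittedValues S a' b' i) ^ 2 =
      ∑ i, center (T - S *ᵥ b') i ^ 2 + n * vecMean e ^ 2 := by
    have hshift : ∀ i, T i - fittedValues S a' b' i =
        center (T - S *ᵥ b') i - vecMean e := fun i => by
      have : vecMean y = vecMean T + vecMean e := by
        rw [hy, vecMean_add, vecMean_add, vecMean_eq_zero hd, add_zero]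
      simp only [fittedValues, center, vecMean_sub, ha', this, Pi.sub_apply]
      ring
    have hcen : ∑ i, center (T - S *ᵥ b') i = 0 := by
      have hn0 : (n : ℝ) ≠ 0 := by exact_mod_cast (by omega : n ≠ 0)
      simp only [center, Finset.sum_sub_distrib]
      simp [vecMean]
      field_simp
      ring
    have hsq : ∀ i, (center (T - S *ᵥ b') i - vecMean e) ^ 2 =
        center (T - S *ᵥ b') i ^ 2 - 2 * vecMean e * center (T - S *ᵥ b') i + vecMean e ^ 2 :=
      fun i => by ring
    simp_rw [hshift, hsq]
    rw [Finset.sum_add_distrib, Finset.sum_sub_distrib, ← Finset.mul_sum, hcen]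
    simp
  have hexp : sqError T S a b = ∑ i, (T i - fittedValues S a b i) ^ 2 := by
    rw [sqError, l2norm_sq]; rfl
  have hdiff : ∀ i, fittedValues S a b i - fittedValues S a' b' i =
      center (S *ᵥ b) i - center (S *ᵥ b') i := fun i => by
    have : a = vecMean y - vecMean (S *ᵥ b) := by linarith
    simp only [fittedValues, center, ha']
    rw [this]
    ring
  have hnoise : 2 * ∑ i, e i * center (S *ᵥ b) i - 2 * ∑ i, e i * center (S *ᵥ b') i =
      2 * ∑ i, e i * (fittedValues S a b i - fittedValues S a' b' i) := by
    simp_rw [hdiff, mul_sub]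
    rw [Finset.sum_sub_distrib, mul_sub]
  have hpt : ∑ i, (T i - fittedValues S a b i) ^ 2 ≤
      ∑ i, (T i - fittedValues S a' b' i) ^ 2 + ∑ i, d i ^ 2
        + 2 * ∑ i, e i * (fittedValues S a b i - fittedValues S a' b' i)
        + 2 * ∑ i, (y i - fittedValues S a b i) *
            (fittedValues S a' b' i - fittedValues S a b i) := by
    rw [Finset.mul_sum, Finset.mul_sum, ← Finset.sum_add_distrib, ← Finset.sum_add_distrib,
      ← Finset.sum_add_distrib]
    refine Finset.sum_le_sum fun i _ => ?_
    rw [hy]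
    simp only [Pi.add_apply]
    -- the squared distance of the two fits absorbs their inner product with `d`
    nlinarith [sq_nonneg (d i + (fittedValues S a' b' i - fittedValues S a b i))]
  rw [hexp, add_sub_assoc, hnoise]
  linarith

/-! ### Integration over the noise and the seed -/

instance (p L : ℕ) : DiscreteMeasurableSpace (HashSeed p L) := ⟨fun _ => trivial⟩

instance (p L : ℕ) : Nonempty (HashSeed p L) := ⟨(fun _ => 1, fun _ _ => 1)⟩

theorem integrable_comp_of_finite {Ω 𝒮 : Type*} [MeasurableSpace Ω] (P : Measure Ω)
    [IsProbabilityMeasure P] [Fintype 𝒮] [MeasurableSpace 𝒮] [DiscreteMeasurableSpace 𝒮]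
    {seed : Ω → 𝒮} (hseed : Measurable seed) (h : 𝒮 → ℝ) :
    Integrable (fun ω => h (seed ω)) P := by
  have := Measure.isProbabilityMeasure_map (μ := P) hseed.aemeasurable
  exact (Integrable.of_finite (f := h) (μ := P.map seed)).comp_measurable hseed

theorem integral_comp_uniform {Ω 𝒮 : Type*} [MeasurableSpace Ω] (P : Measure Ω)
    [IsProbabilityMeasure P] [Fintype 𝒮] [MeasurableSpace 𝒮] [DiscreteMeasurableSpace 𝒮]
    {seed : Ω → 𝒮} (hseed : Measurable seed)
    (hunif : ∀ s, P.real (seed ⁻¹' {s}) = 1 / (Fintype.card 𝒮 : ℝ)) (h : 𝒮 → ℝ) :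
    ∫ ω, h (seed ω) ∂P = 𝔼 s, h s := by
  have := Measure.isProbabilityMeasure_map (μ := P) hseed.aemeasurable
  rw [← integral_map hseed.aemeasurable (f := h) Measurable.of_discrete.aestronglyMeasurable,
    integral_fintype Integrable.of_finite, Fintype.expect_eq_sum_div_card, Finset.sum_div]
  refine Finset.sum_congr rfl fun s _ => ?_
  rw [map_measureReal_apply hseed (measurableSet_singleton s), hunif, smul_eq_mul]
  ring

/-- Random vectors `u (seed)` and `ε` with independent `seed` and `ε`: if `ε` has mean zero, so has
their inner product. -/
theorem integral_sum_mul_noise {Ω 𝒮 : Type*} [MeasurableSpace Ω] (P : Measure Ω)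
    [IsProbabilityMeasure P] [Fintype 𝒮] [MeasurableSpace 𝒮] [DiscreteMeasurableSpace 𝒮] {n : ℕ}
    {seed : Ω → 𝒮} (hseed : Measurable seed) {ε : Ω → Fin n → ℝ}
    (hε2 : ∀ i, MemLp (fun ω => ε ω i) 2 P) (hεmean : ∀ i, ∫ ω, ε ω i ∂P = 0)
    (hindep : IndepFun seed ε P) (u : 𝒮 → Fin n → ℝ) :
    Integrable (fun ω => ∑ i, ε ω i * u (seed ω) i) P ∧
      ∫ ω, ∑ i, ε ω i * u (seed ω) i ∂P = 0 := by
  have hind : ∀ i, IndepFun (fun ω => ε ω i) (fun ω => u (seed ω) i) P := fun i =>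
    (hindep.comp (φ := fun s => u s i) (ψ := fun x : Fin n → ℝ => x i) Measurable.of_discrete
      (measurable_pi_apply i)).symm
  have hint : ∀ i, Integrable (fun ω => ε ω i * u (seed ω) i) P := fun i =>
    (hind i).integrable_mul ((hε2 i).integrable one_le_two)
      (integrable_comp_of_finite P hseed fun s => u s i)
  refine ⟨integrable_finsetSum _ fun i _ => hint i, ?_⟩
  rw [integral_finsetSum _ fun i _ => hint i]
  refine Finset.sum_eq_zero fun i _ => ?_
  rw [(hind i).integral_fun_mul_eq_mul_integral (hε2 i).aestronglyMeasurable
    (integrable_comp_of_finite P hseed fun s => u s i).aestronglyMeasurable, hεmean, zero_mul]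

/-- If `ε` is moreover uncorrelated, the cross terms of the second moment vanish. -/
theorem integral_sum_mul_noise_sq {Ω 𝒮 : Type*} [MeasurableSpace Ω] (P : Measure Ω)
    [IsProbabilityMeasure P] [Fintype 𝒮] [MeasurableSpace 𝒮] [DiscreteMeasurableSpace 𝒮] {n : ℕ}
    {seed : Ω → 𝒮} (hseed : Measurable seed)
    (hunif : ∀ s, P.real (seed ⁻¹' {s}) = 1 / (Fintype.card 𝒮 : ℝ)) {ε : Ω → Fin n → ℝ}
    (hε2 : ∀ i, MemLp (fun ω => ε ω i) 2 P) (hεmean : ∀ i, ∫ ω, ε ω i ∂P = 0) {σ : ℝ}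
    (hεvar : ∀ i, ∫ ω, ε ω i ^ 2 ∂P = σ ^ 2)
    (hεcov : ∀ i j, i ≠ j → cov[fun ω => ε ω i, fun ω => ε ω j; P] = 0)
    (hindep : IndepFun seed ε P) (u : 𝒮 → Fin n → ℝ) :
    Integrable (fun ω => (∑ i, ε ω i * u (seed ω) i) ^ 2) P ∧
      ∫ ω, (∑ i, ε ω i * u (seed ω) i) ^ 2 ∂P = σ ^ 2 * 𝔼 s, ∑ i, u s i ^ 2 := by
  have hind : ∀ i j, IndepFun (fun ω => ε ω i * ε ω j) (fun ω => u (seed ω) i * u (seed ω) j) P :=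
    fun i j => (hindep.comp (φ := fun s => u s i * u s j) (ψ := fun x : Fin n → ℝ => x i * x j)
      Measurable.of_discrete ((measurable_pi_apply i).mul (measurable_pi_apply j))).symm
  have hεε : ∀ i j, Integrable (fun ω => ε ω i * ε ω j) P := fun i j =>
    (hε2 i).integrable_mul (hε2 j)
  have huu : ∀ i j, Integrable (fun ω => u (seed ω) i * u (seed ω) j) P := fun i j =>
    integrable_comp_of_finite P hseed fun s => u s i * u s j
  have hint : ∀ i j, Integrable (fun ω => (ε ω i * ε ω j) * (u (seed ω) i * u (seed ω) j)) P :=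
    fun i j => (hind i j).integrable_mul (hεε i j) (huu i j)
  have hsq : ∀ ω, (∑ i, ε ω i * u (seed ω) i) ^ 2 =
      ∑ i, ∑ j, (ε ω i * ε ω j) * (u (seed ω) i * u (seed ω) j) := fun ω => by
    rw [sq, Finset.sum_mul_sum]
    exact Finset.sum_congr rfl fun i _ => Finset.sum_congr rfl fun j _ => by ring
  have hmom : ∀ i j, ∫ ω, ε ω i * ε ω j ∂P = if i = j then σ ^ 2 else 0 := fun i j => by
    split_ifs with hij
    · subst hij
      rw [← hεvar i]
      simp_rw [sq]
    · have h := hεcov i j hij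
      rw [covariance_eq_sub (hε2 i) (hε2 j), hεmean, zero_mul, sub_zero] at h
      exact h
  simp_rw [hsq]
  refine ⟨integrable_finsetSum _ fun i _ => integrable_finsetSum _ fun j _ => hint i j, ?_⟩
  rw [integral_finsetSum _ fun i _ => integrable_finsetSum _ fun j _ => hint i j,
    Finset.expect_sum_comm, Finset.mul_sum]
  refine Finset.sum_congr rfl fun i _ => ?_
  rw [integral_finsetSum _ fun j _ => hint i j, Finset.sum_eq_single i]
  · rw [(hind i i).integral_fun_mul_eq_mul_integral (hεε i i).aestronglyMeasurable
      (huu i i).aestronglyMeasurable, hmom, if_pos rfl,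
      integral_comp_uniform P hseed hunif fun s => u s i * u s i]
    simp_rw [sq]
  · intro j _ hj
    rw [(hind i j).integral_fun_mul_eq_mul_integral (hεε i j).aestronglyMeasurable
      (huu i j).aestronglyMeasurable, hmom, if_neg hj.symm, zero_mul]
  · simp

/-- A linear form in an admissible coefficient vector, bounded by the Cauchy-Schwarz inequality and
`2 * x ≤ x ^ 2 / k + k`. -/
theorem two_mul_sum_mul_le {L : ℕ} {b v : Fin L → ℝ} {r k : ℝ} (hb : l2norm b ^ 2 ≤ r)
    (hk : 0 < k) : 2 * ∑ l, b l * v l ≤ √r * ((∑ l, v l ^ 2) / k + k) := by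
  have hV : 0 ≤ ∑ l, v l ^ 2 := Finset.sum_nonneg fun _ _ => sq_nonneg _
  have hcs : ∑ l, b l * v l ≤ √r * √(∑ l, v l ^ 2) := by
    refine (Real.sum_mul_le_sqrt_mul_sqrt _ b v).trans ?_
    rw [l2norm_sq] at hb
    gcongr
  have ham : 2 * √(∑ l, v l ^ 2) ≤ (∑ l, v l ^ 2) / k + k := by
    rw [← sub_nonneg]
    have h : (∑ l, v l ^ 2) / k + k - 2 * √(∑ l, v l ^ 2) = (√(∑ l, v l ^ 2) - k) ^ 2 / k := by
      field_simp
      nlinarith [Real.sq_sqrt hV]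
    rw [h]
    positivity
  calc 2 * ∑ l, b l * v l ≤ √r * (2 * √(∑ l, v l ^ 2)) := by linarith
    _ ≤ _ := by gcongr

theorem center_mulVec {n L : ℕ} (S : Matrix (Fin n) (Fin L) ℝ) (b : Fin L → ℝ) (i : Fin n) :
    center (S *ᵥ b) i = ∑ l, b l * center (fun j => S j l) i := by
  simp only [center, vecMean, Matrix.mulVec, dotProduct, mul_sub]
  rw [Finset.sum_sub_distrib, Finset.sum_comm, Finset.sum_div]
  congr 1
  · exact Finset.sum_congr rfl fun l _ => mul_comm _ _
  · refine Finset.sum_congr rfl fun l _ => ?_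
    rw [← mul_div_assoc, Finset.mul_sum]
    simp_rw [mul_comm]

theorem abs_signHash_le {n p L : ℕ} (X : Matrix (Fin n) (Fin p) ℝ) (hX : ∀ i k, |X i k| ≤ 1)
    (s : HashSeed p L) (i : Fin n) (l : Fin L) : |signHash X s i l| ≤ 1 := by
  rw [signHash_apply]
  exact abs_hashEntry_le X hX i _

theorem measurable_sqError {Ω : Type*} [MeasurableSpace Ω] {n p L : ℕ}
    (X : Matrix (Fin n) (Fin p) ℝ) {seed : Ω → HashSeed p L} (hseed : Measurable seed)
    {a : Ω → ℝ} {b : Ω → Fin L → ℝ} (ha : Measurable a) (hb : Measurable b) (T : Fin n → ℝ) :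
    Measurable fun ω => sqError T (signHash X (seed ω)) (a ω) (b ω) := by
  simp only [sqError, l2norm_sq, Pi.sub_apply, fittedValues, Matrix.mulVec, dotProduct]
  have hS : ∀ i l, Measurable fun ω => signHash X (seed ω) i l := fun i l =>
    (Measurable.of_discrete (f := fun s : HashSeed p L => signHash X s i l)).comp hseed
  have hb' : ∀ l, Measurable fun ω => b ω l := fun l => (measurable_pi_apply l).comp hb
  fun_prop

/-- Both error bounds at once: the error is measured relative to `α + X β + γ₁`, and the responses
have the additional systematic perturbation `γ₂`. -/
theorem integral_sqError_le
    {n p q L : ℕ} (hn : 1 ≤ n) (hq : 1 ≤ q) (hL : 1 ≤ L)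
    (X : Matrix (Fin n) (Fin p) ℝ) (hX : ∀ i k, |X i k| ≤ 1)
    (hXq : ∀ i, (activeSet X i).card = q)
    (α : ℝ) (β : Fin p → ℝ) (γ₁ γ₂ : Fin n → ℝ) (hγ₂ : ∑ i, γ₂ i = 0)
    {σ : ℝ} (hσ : 0 < σ) {η : ℝ} (hη : 0 < η)
    {Ω : Type*} [MeasurableSpace Ω] (P : Measure Ω) [IsProbabilityMeasure P]
    {ε : Ω → Fin n → ℝ} (hε2 : ∀ i, MemLp (fun ω => ε ω i) 2 P)
    (hεmean : ∀ i, ∫ ω, ε ω i ∂P = 0) (hεvar : ∀ i, ∫ ω, ε ω i ^ 2 ∂P = σ ^ 2)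
    (hεcov : ∀ i j, i ≠ j → cov[fun ω => ε ω i, fun ω => ε ω j; P] = 0)
    {seed : Ω → HashSeed p L} (hseed : Measurable seed)
    (hunif : ∀ s, P.real (seed ⁻¹' {s}) = 1 / (Fintype.card (HashSeed p L) : ℝ))
    (hindep : IndepFun seed ε P)
    {Y : Ω → Fin n → ℝ} (hY : ∀ ω i, Y ω i = α + ((X *ᵥ β) i + γ₁ i) + γ₂ i + ε ω i)
    {αhat : Ω → ℝ} {bhat : Ω → Fin L → ℝ} (hαhat : Measurable αhat) (hbhat : Measurable bhat)
    (hfit : ∀ᵐ ω ∂P, IsRidgeFit (signHash X (seed ω)) (Y ω) (ridgeRadiusSq p q L β η)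
      (αhat ω) (bhat ω)) :
    Integrable (fun ω => sqError (fun i => α + ((X *ᵥ β) i + γ₁ i))
        (signHash X (seed ω)) (αhat ω) (bhat ω)) P ∧
      ∫ ω, sqError (fun i => α + ((X *ᵥ β) i + γ₁ i))
        (signHash X (seed ω)) (αhat ω) (bhat ω) ∂P ≤
      2 * (√(ridgeRadiusSq p q L β η) * (σ * √(n * L)))
        + n * ((2 - (q : ℝ) / p) * q * l2norm β ^ 2 / L)
        + ridgeRho p q L η * ∑ i, center (fun i => (X *ᵥ β) i + γ₁ i) i ^ 2
        + ∑ i, γ₁ i ^ 2 + ∑ i, γ₂ i ^ 2 + σ ^ 2 := by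
  have hn0 : 0 < (n : ℝ) := by exact_mod_cast (by omega : 0 < n)
  have hL0 : 0 < (L : ℝ) := by exact_mod_cast (by omega : 0 < L)
  have hqp : q ≤ p := by
    rw [← hXq ⟨0, by omega⟩]
    simpa using Finset.card_le_univ (activeSet X ⟨0, by omega⟩)
  have hδ1 : (q : ℝ) / p ≤ 1 := div_le_one_of_le₀ (by exact_mod_cast hqp) (by positivity)
  obtain ⟨b, hb1, hb2, hb3⟩ := exists_signHash_approximation hq hqp hL X hX hXq β hη
  set r := ridgeRadiusSq p q L β η with hr
  have hr0 : 0 ≤ r := by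
    have : 0 ≤ 2 - (q : ℝ) / p := by linarith
    rw [hr, ridgeRadiusSq]
    positivity
  set V := (2 - (q : ℝ) / p) * q * l2norm β ^ 2 / L with hV
  set t : Fin n → ℝ := fun i => (X *ᵥ β) i + γ₁ i with ht
  set T : Fin n → ℝ := fun i => α + t i with hT
  have hcT : center T = center t := by
    ext i
    simp only [center, hT]
    rw [vecMean_const_add hn]
    ring
  -- the comparison coefficients are replaced by zero where they violate the constraint
  let b' : HashSeed p L → Fin L → ℝ := fun s => if l2norm (b s) ^ 2 ≤ r then b s else 0
  have hb' : ∀ s, l2norm (b' s) ^ 2 ≤ r := fun s => by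
    simp only [b']
    split_ifs with h
    · exact h
    · simpa [l2norm] using hr0
  let D : HashSeed p L → ℝ := fun s => ∑ i, center (T - signHash X s *ᵥ b' s) i ^ 2
  let v : HashSeed p L → Fin L → Fin n → ℝ := fun s l => center fun j => signHash X s j l
  let u : HashSeed p L → Fin n → ℝ := fun s => center (signHash X s *ᵥ b' s)
  -- `k ^ 2` bounds the second moment of the noise seen by the columns
  obtain ⟨k, hk⟩ : ∃ k, k = σ * √(n * L) := ⟨_, rfl⟩
  have hk0 : 0 < k := by rw [hk]; positivity
  -- the expected approximation error
  have hD : 𝔼 s, D s ≤ n * V + ridgeRho p q L η * ∑ i, center t i ^ 2 + ∑ i, γ₁ i ^ 2 := by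
    have hpt : ∀ s, D s ≤ ∑ i, (t i - (signHash X s *ᵥ b s) i) ^ 2 +
        (if r < l2norm (b s) ^ 2 then (1 : ℝ) else 0) * ∑ i, center t i ^ 2 := fun s => by
      simp only [D, b']
      rw [center_sub, hcT]
      split_ifs with h h' h'
      · exact absurd h (not_le.2 h')
      · rw [← center_sub, zero_mul, add_zero]
        exact sum_center_sq_le hn _
      · have h0 : center (signHash X s *ᵥ (0 : Fin L → ℝ)) = 0 := by
          ext i; simp [center, vecMean]
        rw [h0, sub_zero, one_mul]
        have : 0 ≤ ∑ i, (t i - (signHash X s *ᵥ b s) i) ^ 2 :=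
          Finset.sum_nonneg fun _ _ => sq_nonneg _
        linarith
      · exact absurd (not_le.1 h) h'
    have hrow : ∀ i, 𝔼 s, (t i - (signHash X s *ᵥ b s) i) ^ 2 ≤ V + γ₁ i ^ 2 := fun i => by
      have hexp : ∀ s, (t i - (signHash X s *ᵥ b s) i) ^ 2 =
          ((signHash X s *ᵥ b s) i - (X *ᵥ β) i) ^ 2 -
            (2 * γ₁ i * (signHash X s *ᵥ b s) i - (2 * γ₁ i * (X *ᵥ β) i + γ₁ i ^ 2)) :=
        fun s => by simp only [ht]; ring
      simp_rw [hexp]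
      rw [Finset.expect_sub_distrib, Finset.expect_sub_distrib, ← Finset.mul_expect, hb1,
        Finset.expect_const (Finset.univ_nonempty (α := HashSeed p L))]
      linarith [hb2 i]
    refine (Finset.expect_le_expect fun s _ => hpt s).trans ?_
    rw [Finset.expect_add_distrib, ← Finset.expect_mul, Finset.expect_sum_comm]
    have h1 : ∑ i, 𝔼 s, (t i - (signHash X s *ᵥ b s) i) ^ 2 ≤ n * V + ∑ i, γ₁ i ^ 2 := by
      refine (Finset.sum_le_sum fun i _ => hrow i).trans_eq ?_
      rw [Finset.sum_add_distrib]
      simp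
    have h2 := mul_le_mul_of_nonneg_right hb3
      (Finset.sum_nonneg fun i _ => sq_nonneg (center t i) : 0 ≤ ∑ i, center t i ^ 2)
    linarith
  -- the mean of the noise
  have hbar := integral_sum_mul_noise_sq P hseed hunif hε2 hεmean hεvar hεcov hindep
    fun _ _ => 1 / (n : ℝ)
  have hbar' : ∀ ω, (∑ i, ε ω i * (1 / (n : ℝ))) ^ 2 = vecMean (ε ω) ^ 2 := fun ω => by
    rw [← Finset.sum_mul, vecMean, mul_one_div]
  simp_rw [hbar'] at hbar
  rw [Finset.expect_const (Finset.univ_nonempty (α := HashSeed p L))] at hbar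
  -- the noise seen by the columns of the compressed matrix
  have hcol := fun l => integral_sum_mul_noise_sq P hseed hunif hε2 hεmean hεvar hεcov hindep
    fun s => v s l
  have hcolb : ∀ s l, ∑ i, v s l i ^ 2 ≤ n := fun s l => by
    refine (sum_center_sq_le hn _).trans ?_
    refine (Finset.sum_le_sum (g := fun _ => (1 : ℝ)) fun i _ =>
      (sq_le_one_iff_abs_le_one _).2 (abs_signHash_le X hX s i l)).trans_eq ?_
    simp
  have hu := integral_sum_mul_noise P hseed hε2 hεmean hindep u
  let R : Ω → ℝ := fun ω => n * vecMean (ε ω) ^ 2 + D (seed ω) + ∑ i, γ₂ i ^ 2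
    + √r * ((∑ l, (∑ i, ε ω i * v (seed ω) l i) ^ 2) / k + k)
    - 2 * ∑ i, ε ω i * u (seed ω) i
  have hDint := integrable_comp_of_finite P hseed D
  have hcolint : Integrable (fun ω => ∑ l, (∑ i, ε ω i * v (seed ω) l i) ^ 2) P :=
    integrable_finsetSum _ fun l _ => (hcol l).1
  have i1 : Integrable (fun ω => n * vecMean (ε ω) ^ 2) P := hbar.1.const_mul _
  have i2 : Integrable (fun ω => n * vecMean (ε ω) ^ 2 + D (seed ω)) P := i1.add hDint
  have i3 : Integrable (fun ω => n * vecMean (ε ω) ^ 2 + D (seed ω) + ∑ i, γ₂ i ^ 2) P :=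
    i2.add (integrable_const _)
  have i4' : Integrable (fun ω => (∑ l, (∑ i, ε ω i * v (seed ω) l i) ^ 2) / k + k) P :=
    (hcolint.div_const k).add (integrable_const k)
  have i4 : Integrable
      (fun ω => √r * ((∑ l, (∑ i, ε ω i * v (seed ω) l i) ^ 2) / k + k)) P := i4'.const_mul _
  have i5 : Integrable (fun ω => n * vecMean (ε ω) ^ 2 + D (seed ω) + ∑ i, γ₂ i ^ 2
      + √r * ((∑ l, (∑ i, ε ω i * v (seed ω) l i) ^ 2) / k + k)) P := i3.add i4
  have i6 : Integrable (fun ω => 2 * ∑ i, ε ω i * u (seed ω) i) P := hu.1.const_mul 2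
  have hRint : Integrable R P := i5.sub i6
  have hle : ∀ᵐ ω ∂P, sqError T (signHash X (seed ω)) (αhat ω) (bhat ω) ≤ R ω := by
    filter_upwards [hfit] with ω hω
    have hyω : Y ω = T + γ₂ + ε ω := by
      ext i
      simp [hY, hT, ht]
    have h1 := hω.sqError_le hn hyω hγ₂ (hb' (seed ω))
    have h2 := two_mul_sum_mul_le (v := fun l => ∑ i, ε ω i * v (seed ω) l i) hω.1 hk0
    have h3 : ∑ i, ε ω i * center (signHash X (seed ω) *ᵥ bhat ω) i =
        ∑ l, bhat ω l * ∑ i, ε ω i * v (seed ω) l i := by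
      simp_rw [center_mulVec, Finset.mul_sum]
      rw [Finset.sum_comm]
      exact Finset.sum_congr rfl fun l _ => Finset.sum_congr rfl fun i _ => by
        simp only [v]; ring
    rw [h3] at h1
    simp only [R, D, u]
    linarith
  have hint : Integrable
      (fun ω => sqError T (signHash X (seed ω)) (αhat ω) (bhat ω)) P := by
    refine hRint.mono' (measurable_sqError X hseed hαhat hbhat T).aestronglyMeasurable ?_
    filter_upwards [hle] with ω hω
    exact (Real.norm_of_nonneg (by exact sq_nonneg _)).trans_le hω
  refine ⟨hint, (integral_mono_ae hint hRint hle).trans ?_⟩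
  have hI : ∫ ω, R ω ∂P = σ ^ 2 + 𝔼 s, D s + ∑ i, γ₂ i ^ 2
      + √r * ((∑ l, σ ^ 2 * 𝔼 s, ∑ i, v s l i ^ 2) / k + k) := by
    simp only [R]
    rw [integral_sub i5 i6, integral_add i3 i4, integral_add i2 (integrable_const _),
      integral_add i1 hDint, integral_const_mul, integral_const_mul, integral_const_mul,
      integral_add (hcolint.div_const k) (integrable_const k), integral_div,
      integral_finsetSum _ fun l _ => (hcol l).1, hu.2, hbar.2,
      integral_comp_uniform P hseed hunif D]
    simp_rw [(hcol _).2]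
    simp
    field_simp
  have hcolsum : (∑ l, σ ^ 2 * 𝔼 s, ∑ i, v s l i ^ 2) / k ≤ k := by
    rw [div_le_iff₀ hk0]
    have h1 : ∀ l, σ ^ 2 * 𝔼 s, ∑ i, v s l i ^ 2 ≤ σ ^ 2 * n := fun l => by
      refine mul_le_mul_of_nonneg_left ?_ (sq_nonneg _)
      exact Finset.expect_le (Finset.univ_nonempty (α := HashSeed p L)) fun s _ => hcolb s l
    refine (Finset.sum_le_sum fun l _ => h1 l).trans_eq ?_
    rw [← sq, hk, mul_pow, Real.sq_sqrt (by positivity)]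
    simp
    ring
  have hnoise : √r * ((∑ l, σ ^ 2 * 𝔼 s, ∑ i, v s l i ^ 2) / k + k) ≤ 2 * (√r * k) := by
    have := mul_le_mul_of_nonneg_left hcolsum (Real.sqrt_nonneg r)
    linarith
  rw [hI, ← hk]
  linarith

/-- The constants of the oracle inequality in terms of `LStar`. -/
theorem noise_add_approximation_div_eq {n p q L : ℕ} (hn : 1 ≤ n) (hq : 1 ≤ q) (hqp : q ≤ p)
    (hL : 1 ≤ L) (β : Fin p → ℝ) {σ η : ℝ} (hσ : 0 < σ) (hη : 0 < η) :
    (2 * (√(ridgeRadiusSq p q L β η) * (σ * √(n * L)))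
        + n * ((2 - (q : ℝ) / p) * q * l2norm β ^ 2 / L)) / n =
      √((2 - (q : ℝ) / p) * q) * l2norm β *
          (σ * (2 * √(1 + η) + LStar n p q β σ / L) / √n) := by
  have hn0 : 0 < (n : ℝ) := by exact_mod_cast (by omega : 0 < n)
  have hL0 : 0 < (L : ℝ) := by exact_mod_cast (by omega : 0 < L)
  have hδ1 : (q : ℝ) / p ≤ 1 := div_le_one_of_le₀ (by exact_mod_cast hqp) (by positivity)
  have hβ := l2norm_nonneg β
  rw [ridgeRadiusSq, LStar]
  obtain ⟨K, hK⟩ : ∃ K, K = (2 - (q : ℝ) / p) * q := ⟨_, rfl⟩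
  have hK0 : 0 ≤ K := by
    rw [hK]
    exact mul_nonneg (by linarith) (by positivity)
  rw [← hK, Real.sqrt_mul (by linarith), Real.sqrt_div (by positivity), Real.sqrt_mul hK0,
    Real.sqrt_sq hβ, Real.sqrt_mul hn0.le, Real.sqrt_mul hK0]
  obtain ⟨x, hx⟩ : ∃ x, x = √K := ⟨_, rfl⟩
  obtain ⟨y, hy⟩ : ∃ y, y = √(n : ℝ) := ⟨_, rfl⟩
  obtain ⟨z, hz⟩ : ∃ z, z = √(L : ℝ) := ⟨_, rfl⟩
  have hy0 : y ≠ 0 := hy ▸ (Real.sqrt_pos.2 hn0).ne'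
  have hz0 : z ≠ 0 := hz ▸ (Real.sqrt_pos.2 hL0).ne'
  have hyn : (n : ℝ) = y ^ 2 := by rw [hy, Real.sq_sqrt hn0.le]
  have hzL : (L : ℝ) = z ^ 2 := by rw [hz, Real.sq_sqrt hL0.le]
  have hxK : K = x ^ 2 := by rw [hx, Real.sq_sqrt hK0]
  rw [← hx, ← hy, ← hz, hyn, hzL, hxK]
  field_simp

end

theorem mainTheorem3
    {n p q L : ℕ} (hn : 1 ≤ n) (hq : 1 ≤ q) (hL : 1 ≤ L)
    -- the design: entries in `[-1, 1]`, exactly `q` of them non-zero in each row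
    (X : Matrix (Fin n) (Fin p) ℝ) (hX : ∀ i k, |X i k| ≤ 1)
    (hXq : ∀ i, (activeSet X i).card = q)
    -- the parameters of the linear model
    (α : ℝ) (β : Fin p → ℝ) (γ : Fin n → ℝ) (hγ : ∑ i, γ i = 0)
    (σ : ℝ) (hσ : 0 < σ) (η : ℝ) (hη : 0 < η)
    {Ω : Type*} [MeasurableSpace Ω] (P : Measure Ω) [IsProbabilityMeasure P]
    -- the noise: centred, uncorrelated, of variance `σ²`
    (ε : Ω → Fin n → ℝ) (hε : Measurable ε) (hε2 : ∀ i, MemLp (fun ω => ε ω i) 2 P)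
    (hεmean : ∀ i, ∫ ω, ε ω i ∂P = 0) (hεvar : ∀ i, ∫ ω, ε ω i ^ 2 ∂P = σ ^ 2)
    (hεcov : ∀ i j, i ≠ j → cov[fun ω => ε ω i, fun ω => ε ω j; P] = 0)
    -- uniformly distributed permutations and signs, independent of the noise
    (seed : Ω → HashSeed p L) (hseed : Measurable seed)
    (hunif : ∀ s, P.real (seed ⁻¹' {s}) = 1 / (Fintype.card (HashSeed p L) : ℝ))
    (hindep : IndepFun seed ε P)
    -- the responses
    (Y : Ω → Fin n → ℝ) (hY : ∀ ω i, Y ω i = α + (X *ᵥ β) i + γ i + ε ω i)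
    -- the constrained least squares estimator
    (αhat : Ω → ℝ) (bhat : Ω → Fin L → ℝ) (hαhat : Measurable αhat) (hbhat : Measurable bhat)
    (hfit : ∀ᵐ ω ∂P, IsRidgeFit (signHash X (seed ω)) (Y ω) (ridgeRadiusSq p q L β η)
      (αhat ω) (bhat ω)) :
    -- error relative to the mean response `α 1 + X β + γ`
    (Integrable (fun ω => sqError (fun i => α + (X *ᵥ β) i + γ i)
        (signHash X (seed ω)) (αhat ω) (bhat ω)) P ∧
      (∫ ω, sqError (fun i => α + (X *ᵥ β) i + γ i)
        (signHash X (seed ω)) (αhat ω) (bhat ω) ∂P) / n ≤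
      √((2 - (q : ℝ) / p) * q) * l2norm β *
          (σ * (2 * √(1 + η) + LStar n p q β σ / L) / √n)
        + ridgeRho p q L η *
          (l2norm (fun i => (X *ᵥ β) i - vecMean (X *ᵥ β) + γ i) ^ 2 / n)
        + l2norm γ ^ 2 / n + σ ^ 2 / n) ∧
    -- error relative to the linear part `α 1 + X β`
    (Integrable (fun ω => sqError (fun i => α + (X *ᵥ β) i)
        (signHash X (seed ω)) (αhat ω) (bhat ω)) P ∧
      (∫ ω, sqError (fun i => α + (X *ᵥ β) i)
        (signHash X (seed ω)) (αhat ω) (bhat ω) ∂P) / n ≤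
      √((2 - (q : ℝ) / p) * q) * l2norm β *
          (σ * (2 * √(1 + η) + LStar n p q β σ / L) / √n)
        + ridgeRho p q L η *
          (l2norm (fun i => (X *ᵥ β) i - vecMean (X *ᵥ β)) ^ 2 / n)
        + l2norm γ ^ 2 / n + σ ^ 2 / n) := by
  have hqp : q ≤ p := by
    rw [← hXq ⟨0, by omega⟩]
    simpa using Finset.card_le_univ (activeSet X ⟨0, by omega⟩)
  have hconst := noise_add_approximation_div_eq hn hq hqp hL β hσ hη
  constructor
  · obtain ⟨hint, hle⟩ := integral_sqError_le hn hq hL X hX hXq α β γ 0 (by simp) hσ hη P hε2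
      hεmean hεvar hεcov hseed hunif hindep (Y := Y) (fun ω i => by rw [hY]; simp; ring)
      hαhat hbhat hfit
    simp_rw [← add_assoc] at hint hle
    refine ⟨hint, ?_⟩
    have hcenter : ∀ i, center (fun i => (X *ᵥ β) i + γ i) i =
        (X *ᵥ β) i - vecMean (X *ᵥ β) + γ i := fun i => by
      change (X *ᵥ β) i + γ i - vecMean (X *ᵥ β + γ) = _
      rw [vecMean_add, vecMean_eq_zero hγ]
      ring
    simp_rw [hcenter] at hle
    rw [l2norm_sq, l2norm_sq, ← hconst, ← mul_div_assoc (ridgeRho p q L η), ← add_div, ← add_div,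
      ← add_div]
    refine div_le_div_of_nonneg_right (hle.trans_eq ?_) (Nat.cast_nonneg n)
    simp
  · obtain ⟨hint, hle⟩ := integral_sqError_le hn hq hL X hX hXq α β 0 γ hγ hσ hη P hε2
      hεmean hεvar hεcov hseed hunif hindep (Y := Y) (fun ω i => by rw [hY]; simp)
      hαhat hbhat hfit
    simp only [Pi.zero_apply, add_zero] at hint hle
    refine ⟨hint, ?_⟩
    simp only [center] at hle
    rw [l2norm_sq, l2norm_sq, ← hconst, ← mul_div_assoc (ridgeRho p q L η), ← add_div, ← add_div,
      ← add_div]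
    refine div_le_div_of_nonneg_right (hle.trans_eq ?_) (Nat.cast_nonneg n)
    simp
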